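/- Let $v=e^{2\pi i/3}$, $w=v^2$, $t=v-w=\sqrt{-3}$, and let $G=G_{27}\rtimes Q_8\rtimes Z_3$ be the group of complex $3\times 3$ matrices, acting on column vectors, generated by $$\begin{pmatrix}1&0&0\\0&v&0\\0&0&w\end{pmatrix},\quad \begin{pmatrix}0&1&0\\0&0&1\\1&0&0\end{pmatrix},\quad -\frac t3\begin{pmatrix}1&1&1\\1&v&w\\1&w&v\end{pmatrix},\quad -\frac t3\begin{pmatrix}1&v&v\\w&v&w\\w&w&v\end{pmatrix},\quad \begin{pmatrix}v&0&0\\0&1&0\\0&0&1\end{pmatrix}$$ (the first two generate $G_{27}$, the next two generate $Q_8$). Write $x\cdot y=\sum_i x_i\overline{y_i}$ on $\mathbb C^3$, and let $\mathcal M$ be the set of the twelve vectors $$\begin{array}{cccc}(t,0,0)&(1,1,1)&(v,1,1)&(w,1,1)\\(0,t,0)&(1,v,w)&(1,1,v)&(1,w,1)\\(0,0,t)&(1,w,v)&(1,v,1)&(1,1,w).\end{array}$$ 1. $|G|=648$. The vectors of $\mathcal M$ span $12$ distinct complex lines (the mirrors), and the $24$ distinct complex reflections $x\mapsto x-\frac{x\cdot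 r}{r\cdot r}(1-\lambda)r$ with $r\in\mathcal M$ and $\lambda\in\{v,w\}$ generate $G$. 2. Regard $\mathbb C^3$ as a real $6$-dimensional Euclidean space with inner product $\operatorname{Re}(x\cdot y)$. The multiples $ur$ with $r\in\mathcal M$ and $u^6=1$ form a set $\Phi$ of exactly $72$ vectors, whose orthogonal reflections $x\mapsto x-\frac{2\operatorname{Re}(x\cdot a)}{\operatorname{Re}(a\cdot a)}a$ $(a\in\Phi)$ are exactly $36$ in number. The set $\Phi$ is a root system of type $E_6$ in $\mathbb R^6$, and the $36$ real reflections generate its Weyl group $W(E_6)$. 3. The realification map, which regards an invertible complex $3\times 3$ matrix as a real linear automorphism of $\mathbb C^3=\mathbb R^6$, is injective, and it maps $G$ onto a maximal subgroup of the rotation subgroup $\{g\in W(E_6):\det\nolimits_{\mathbb R}g=1\}$ of $W(E_6)$. -/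

import Mathlib

noncomputable section

namespace HessianE6

/-- The standard `3`-dimensional complex space, and (by restriction of scalars) the
`6`-dimensional real space underlying it. -/
abbrev V : Type := Fin 3 → ℂ

/-- `v = exp(2πi/3)`. -/
def v : ℂ := Complex.exp (2 * Real.pi * Complex.I / 3)

/-- `w = v² = exp(4πi/3)`. -/
def w : ℂ := v ^ 2

/-- `t = v - w = √-3`. -/
def t : ℂ := v - w

/-- The two generators of the extraspecial group `G₂₇`. -/
def g27a : Matrix (Fin 3) (Fin 3) ℂ := !![1, 0, 0; 0, v, 0; 0, 0, w]
def g27b : Matrix (Fin 3) (Fin 3) ℂ := !![0, 1, 0; 0, 0, 1; 1, 0, 0]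

/-- The two generators of the quaternion group `Q₈`. -/
def q8a : Matrix (Fin 3) (Fin 3) ℂ := (-t / 3) • !![1, 1, 1; 1, v, w; 1, w, v]
def q8b : Matrix (Fin 3) (Fin 3) ℂ := (-t / 3) • !![1, v, v; w, v, w; w, w, v]

/-- The matrix of determinant `v` that generates the last factor `Z₃`. -/
def z3a : Matrix (Fin 3) (Fin 3) ℂ := !![v, 0, 0; 0, 1, 0; 0, 0, 1]

lemma v_sq : v ^ 2 = -1 - v := by
  have h3 : IsPrimitiveRoot v 3 := by
    have := Complex.isPrimitiveRoot_exp 3 (by norm_num)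
    simpa [v] using this
  have h := h3.geom_sum_eq_zero (by norm_num)
  simp only [Finset.sum_range_succ, Finset.sum_range_zero] at h
  linear_combination h

lemma v_ne_zero : v ≠ 0 := Complex.exp_ne_zero _

lemma det_g27a : g27a.det = 1 := by
  simp only [g27a, w, Matrix.det_fin_three, Matrix.of_apply, Matrix.cons_val]
  linear_combination (v - 1) * v_sq

lemma det_g27b : g27b.det = 1 := by
  simp [g27b, Matrix.det_fin_three]

lemma det_q8a : q8a.det = 1 := by
  have h := v_sq
  simp only [q8a, t, w, h, Matrix.det_fin_three, Matrix.of_apply, Matrix.cons_val,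
    Matrix.smul_apply, smul_eq_mul]
  ring_nf
  grind

lemma det_q8b : q8b.det = 1 := by
  have h := v_sq
  simp only [q8b, t, w, h, Matrix.det_fin_three, Matrix.of_apply, Matrix.cons_val,
    Matrix.smul_apply, smul_eq_mul]
  ring_nf
  grind

lemma det_z3a : z3a.det = v := by
  simp [z3a, Matrix.det_fin_three]

/-- The group `G₂₇ ⋊ Q₈ ⋊ Z₃` (the triple cover of the Hessian group), as the group of complex
`3 × 3` matrices generated by the five matrices above. -/
def hessianGroup : Subgroup (GL (Fin 3) ℂ) :=
  Subgroup.closure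
    { Matrix.GeneralLinearGroup.mkOfDetNeZero g27a (by rw [det_g27a]; exact one_ne_zero),
      Matrix.GeneralLinearGroup.mkOfDetNeZero g27b (by rw [det_g27b]; exact one_ne_zero),
      Matrix.GeneralLinearGroup.mkOfDetNeZero q8a (by rw [det_q8a]; exact one_ne_zero),
      Matrix.GeneralLinearGroup.mkOfDetNeZero q8b (by rw [det_q8b]; exact one_ne_zero),
      Matrix.GeneralLinearGroup.mkOfDetNeZero z3a (by rw [det_z3a]; exact v_ne_zero) }

/-- The standard Hermitian form `x.r` on `ℂ³`, linear in `x`. -/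
def hdot (x r : V) : ℂ := ∑ i, x i * star (r i)

/-- Vectors spanning the twelve mirrors. -/
def mirrorVectors : Set V :=
  { ![t, 0, 0], ![1, 1, 1], ![v, 1, 1], ![w, 1, 1],
    ![0, t, 0], ![1, v, w], ![1, 1, v], ![1, w, 1],
    ![0, 0, t], ![1, w, v], ![1, v, 1], ![1, 1, w] }

/-- The twelve mirrors, as complex one-dimensional subspaces. -/
def mirrors : Set (Submodule ℂ V) :=
  (fun r : V => Submodule.span ℂ {r}) '' mirrorVectors

/-- The complex reflections of order `3` in the twelve mirrors:
`x ↦ x - (x.r / r.r) (1 - lam) r` with `lam = v` or `lam = w`. -/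
def complexReflections : Set (GL (Fin 3) ℂ) :=
  { g | ∃ r ∈ mirrorVectors, ∃ lam ∈ ({v, w} : Set ℂ), ∀ x : V,
      (g : Matrix (Fin 3) (Fin 3) ℂ).mulVec x =
        x - (hdot x r / hdot r r * (1 - lam)) • r }

/-- The multiples of the twelve vectors by the six complex units `±1, ±v, ±w`, regarded as vectors
of the real `6`-space. -/
def realRoots : Set V :=
  { a | ∃ r ∈ mirrorVectors, ∃ u : ℂ, u ^ 6 = 1 ∧ a = u • r }

/-- The orthogonal reflections of the real `6`-space, with inner product `Re (x.y)`, that negate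
one of the vectors of `realRoots`. -/
def realReflections : Set (V ≃ₗ[ℝ] V) :=
  { s | ∃ a ∈ realRoots, ∀ x : V,
      s x = x - (2 * (hdot x a).re / (hdot a a).re) • a }

/-- The group generated by the real reflections. -/
def realReflectionGroup : Subgroup (V ≃ₗ[ℝ] V) := Subgroup.closure realReflections

/-- Realification: an invertible complex `3 × 3` matrix as an automorphism of the
real `6`-space. -/
def realify : GL (Fin 3) ℂ →* (V ≃ₗ[ℝ] V) where
  toFun g :=
    { toFun := fun x => (g : Matrix (Fin 3) (Fin 3) ℂ).mulVec x
      invFun := fun x => ((g⁻¹ : GL (Fin 3) ℂ) : Matrix (Fin 3) (Fin 3) ℂ).mulVec x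
      map_add' := fun x y => Matrix.mulVec_add _ x y
      map_smul' := fun c x => Matrix.mulVec_smul _ c x
      left_inv := fun x => by beta_reduce; rw [Matrix.mulVec_mulVec, ← Units.val_mul]; simp
      right_inv := fun x => by beta_reduce; rw [Matrix.mulVec_mulVec, ← Units.val_mul]; simp }
  map_one' := by ext1 x; exact Matrix.one_mulVec x
  map_mul' g h := by ext1 x; exact (Matrix.mulVec_mulVec x _ _).symm

/-- `Φ` is a root system of type `E₆` in the real vector space `M`, and `W` is its Weyl group
(acting on `M`): `Φ` is the set of roots of a crystallographic root system which has a base with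
Cartan matrix `E₆`, and `W` is the image of the Weyl group of that root system. -/
def IsE6WeylGroup {M : Type*} [AddCommGroup M] [Module ℝ M]
    (Φ : Set M) (W : Subgroup (M ≃ₗ[ℝ] M)) : Prop :=
  ∃ (P : RootPairing Φ ℝ M (Module.Dual ℝ M)) (_ : P.IsRootSystem) (_ : P.IsCrystallographic)
    (b : P.Base) (e : Fin 6 ≃ b.support),
    (∀ α : Φ, P.root α = (α : M)) ∧
    b.cartanMatrix.submatrix e e = CartanMatrix.E₆ ∧
    P.weylGroup.map (RootPairing.Equiv.weightHom P) = W

/-- The rotation subgroup of a group of real linear automorphisms of the real `6`-space: its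
elements of (real) determinant `1`. -/
def rotationSubgroup (W : Subgroup (V ≃ₗ[ℝ] V)) : Subgroup (V ≃ₗ[ℝ] V) :=
  W ⊓ (LinearEquiv.det : (V ≃ₗ[ℝ] V) →* ℝˣ).ker

/-- `H` is a maximal subgroup of `K`: it is a proper subgroup of `K`, and the only subgroup of `K`
that properly contains it is `K`. -/
def IsMaximalSubgroupOf {G : Type*} [Group G] (H K : Subgroup G) : Prop :=
  H < K ∧ ∀ L : Subgroup G, H < L → L ≤ K → L = K

end HessianE6

end

/-!
The roots are the vectors of norm `3` in the lattice `Λ` of vectors of Eisenstein integers whose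
entries are congruent modulo `√-3`. The real reflections preserve `Λ` and act trivially on the
quotient `Λ*/Λ` of its dual, hence they permute the roots. Moreover, a complex-linear element of the
group they generate that fixes the root `(√-3, 0, 0)` is diagonal with entries `1, a, b`, where
`a³ = b³ = 1`: the action on `Λ*/Λ` rules out permutations and signs. As `G` is transitive on the
roots, it consists of all complex-linear elements, and its order is `72 * 9`.

For maximality, let `L` be a subgroup of the rotation subgroup strictly containing `G`, and `g ∈ L`
outside `G`. If `g` mapped the complex line of each root to a complex line, it would be
complex-linear on some roots and antilinear on the others; the relations between roots make it one
or the other on all of `ℂ³`. It is not linear because `g ∉ G`, and not antilinear because complex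
conjugation is a product of three reflections and so has determinant `-1`. Hence, after
multiplication by an element of `G`, `g` sends some root `a` to `(√-3, 0, 0)` and `v • a` to a root
outside its complex line. The products of two reflections in `L` define an equivalence relation on
the roots that is invariant under `L` and identifies the roots of a complex line; this
identification of two lines propagates under `G` to all roots, so `L` is the rotation subgroup.
-/

noncomputable section

namespace HessianE6

open scoped QuadraticAlgebra

/-! ### Groups generated by involutions -/

theorem closure_inf_ker_le_of_forall_mul_mem {G A : Type*} [Group G] [CommGroup A] {S : Set G}
    {L : Subgroup G} {χ : G →* A} {ε : A} (hε : ε ≠ 1) (hχ : ∀ s ∈ S, χ s = ε)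
    (hS : ∀ s ∈ S, s * s = 1) (hL : ∀ s ∈ S, ∀ r ∈ S, s * r ∈ L) :
    Subgroup.closure S ⊓ χ.ker ≤ L := by
  have dichotomy : ∀ g ∈ Subgroup.closure S,
      (χ g = 1 ∧ g ∈ L) ∨ (χ g = ε ∧ ∀ s ∈ S, s * g ∈ L) := by
    have mul_left : ∀ s ∈ S, ∀ g, (χ g = 1 ∧ g ∈ L) ∨ (χ g = ε ∧ ∀ s ∈ S, s * g ∈ L) →
        (χ (s * g) = 1 ∧ s * g ∈ L) ∨ (χ (s * g) = ε ∧ ∀ r ∈ S, r * (s * g) ∈ L) := by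
      rintro s hs g (⟨h1, hg⟩ | ⟨h1, hg⟩)
      · refine .inr ⟨by rw [map_mul, h1, hχ s hs, mul_one], fun r hr => ?_⟩
        rw [← mul_assoc]
        exact mul_mem (hL r hr s hs) hg
      · refine .inl ⟨?_, hg s hs⟩
        rw [map_mul, h1, hχ s hs, ← hχ s hs, ← map_mul, hS s hs, map_one]
    intro g hg
    induction hg using Subgroup.closure_induction_left with
    | one => exact .inl ⟨map_one χ, one_mem L⟩
    | mul_left s hs g _ ih => exact mul_left s hs g ih
    | inv_mul_cancel s hs g _ ih =>
      rw [inv_eq_of_mul_eq_one_left (hS s hs)]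
      exact mul_left s hs g ih
  rintro g ⟨hg, hg1⟩
  exact (dichotomy g hg).elim And.right fun h => absurd (h.1.symm.trans hg1) hε

/-! ### Orthogonal reflections -/

section Reflection

variable {K M : Type*} [Field K] [AddCommGroup M] [Module K M]

/-- The reflection `x ↦ x - (2 B(x, a) / B(a, a)) a` that negates `a` and, when `B` is symmetric and
`B(a, a) ≠ 0`, fixes the orthogonal complement of `a`. It is the identity if `B(a, a) = 0`. -/
def orthogonalReflection (B : LinearMap.BilinForm K M) (a : M) : M ≃ₗ[K] M :=
  LinearEquiv.ofInvolutive
    (LinearMap.id - ((2 / B a a) • LinearMap.flip B a).smulRight a) <| by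
    intro x
    by_cases ha : B a a = 0
    · simp [ha]
    · simp only [LinearMap.sub_apply, LinearMap.id_apply, LinearMap.smulRight_apply,
        LinearMap.smul_apply, LinearMap.flip_apply, map_sub, map_smul, smul_eq_mul]
      match_scalars <;> field_simp
      ring

variable {B : LinearMap.BilinForm K M}

theorem orthogonalReflection_apply (a x : M) :
    orthogonalReflection B a x = x - (2 * B x a / B a a) • a := by
  simp [orthogonalReflection, LinearEquiv.ofInvolutive, div_mul_eq_mul_div]

theorem orthogonalReflection_mul_self (a : M) :
    orthogonalReflection B a * orthogonalReflection B a = 1 :=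
  LinearEquiv.ext <| (orthogonalReflection B a).left_inv

theorem orthogonalReflection_inv (a : M) :
    (orthogonalReflection B a)⁻¹ = orthogonalReflection B a :=
  inv_eq_of_mul_eq_one_left (orthogonalReflection_mul_self a)

theorem orthogonalReflection_neg (a : M) :
    orthogonalReflection B (-a) = orthogonalReflection B a := by
  ext x
  simp [orthogonalReflection_apply, neg_div]

theorem orthogonalReflection_conj {g : M ≃ₗ[K] M} (hg : ∀ x y, B (g x) (g y) = B x y) (a : M) :
    g * orthogonalReflection B a * g⁻¹ = orthogonalReflection B (g a) := by
  ext x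
  obtain ⟨y, rfl⟩ := g.surjective x
  have hgy : g⁻¹ (g y) = y := g.symm_apply_apply y
  simp [orthogonalReflection_apply, LinearEquiv.mul_apply, hgy, hg]

theorem apply_orthogonalReflection (hB : B.IsSymm) {a : M} (ha : B a a ≠ 0) (x y : M) :
    B (orthogonalReflection B a x) (orthogonalReflection B a y) = B x y := by
  simp only [orthogonalReflection_apply, map_sub, map_smul, LinearMap.sub_apply,
    LinearMap.smul_apply, smul_eq_mul, hB.eq a y]
  field_simp
  ring

theorem det_orthogonalReflection [FiniteDimensional K M] {a : M} (ha : B a a ≠ 0) :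
    LinearEquiv.det (orthogonalReflection B a) = -1 := by
  have h : (orthogonalReflection B a : M →ₗ[K] M) =
      LinearMap.transvection (-(2 / B a a) • LinearMap.flip B a) a := by
    ext x
    simp [orthogonalReflection_apply, LinearMap.transvection.apply, div_mul_eq_mul_div,
      sub_eq_add_neg]
  apply Units.ext
  rw [LinearEquiv.coe_det, h, LinearMap.transvection.det]
  simp only [LinearMap.smul_apply, LinearMap.flip_apply, smul_eq_mul, neg_mul,
    div_mul_cancel₀ _ ha, Units.val_neg, Units.val_one]
  norm_num

theorem exists_smul_eq_of_orthogonalReflection_eq [CharZero K] {a b : M} (hb : B b b ≠ 0)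
    (h : orthogonalReflection B a = orthogonalReflection B b) : ∃ c : K, b = c • a := by
  refine ⟨B b a / B a a, ?_⟩
  have hb' := LinearEquiv.congr_fun h b
  simp only [orthogonalReflection_apply, mul_div_assoc, div_self hb, mul_one] at hb'
  have h2 : (2 : K) • b = (2 : K) • (B b a / B a a) • a := by
    rw [smul_smul]
    exact (sub_right_inj.1 hb').symm
  exact smul_right_injective M two_ne_zero h2

end Reflection

/-! ### Complex roots of unity -/

section RootsOfUnity

variable {n : ℕ} [NeZero n]

theorem setOf_pow_eq_one_eq_nthRootsFinset :
    {u : ℂ | u ^ n = 1} = Polynomial.nthRootsFinset n (1 : ℂ) :=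
  Set.ext fun _ => (Polynomial.mem_nthRootsFinset (NeZero.pos n) 1).symm

theorem ncard_setOf_pow_eq_one : {u : ℂ | u ^ n = 1}.ncard = n := by
  rw [setOf_pow_eq_one_eq_nthRootsFinset, Set.ncard_coe_finset,
    (Complex.isPrimitiveRoot_exp n (NeZero.ne n)).card_nthRootsFinset]

theorem star_mul_self_of_pow_eq_one {u : ℂ} (hu : u ^ n = 1) : star u * u = 1 := by
  rw [Complex.star_def, Complex.conj_mul', Complex.norm_eq_one_of_pow_eq_one hu (NeZero.ne n),
    Complex.ofReal_one, one_pow]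

end RootsOfUnity

/-! ### Eisenstein integers -/

/-- The ring `ℤ[ω]` of Eisenstein integers, `ω² = -1 - ω`, as a ring with decidable equality, so
that identities between the coordinates of roots can be decided. -/
abbrev Eisenstein : Type := QuadraticAlgebra ℤ (-1) (-1)

/-- The embedding of the Eisenstein integers into `ℂ` with `ω ↦ v`. -/
def eis : Eisenstein →+* ℂ :=
  (QuadraticAlgebra.lift ⟨v, by
    rw [← sq, v_sq, neg_one_smul, neg_one_smul, sub_eq_add_neg]⟩ : Eisenstein →ₐ[ℤ] ℂ)

/-- The reduction of an Eisenstein integer modulo the prime `√-3`, which sends `ω` to `1`. -/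
def residue : Eisenstein →+* ZMod 3 :=
  (QuadraticAlgebra.lift ⟨1, by decide⟩ : Eisenstein →ₐ[ℤ] ZMod 3)

/-- The square root `1 + 2ω` of `-3`. -/
def theta : Eisenstein := ⟨1, 2⟩

theorem eis_apply (p : Eisenstein) : eis p = p.re + p.im * v := by
  simp [eis, QuadraticAlgebra.lift]

theorem residue_apply (p : Eisenstein) : residue p = p.re + p.im := by
  simp [residue, QuadraticAlgebra.lift]

theorem isPrimitiveRoot_v : IsPrimitiveRoot v 3 := by
  simpa [v] using Complex.isPrimitiveRoot_exp 3 three_ne_zero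

theorem v_pow_three : v ^ 3 = 1 := isPrimitiveRoot_v.pow_eq_one

theorem star_v : star v = w :=
  mul_right_cancel₀ v_ne_zero <| by
    rw [star_mul_self_of_pow_eq_one v_pow_three, w, ← pow_succ, v_pow_three]

theorem v_re : v.re = -1 / 2 := by
  have h : v + star v = -1 := by rw [star_v, w, v_sq]; ring
  have := congrArg Complex.re h
  simp only [Complex.add_re, Complex.star_def, Complex.conj_re, Complex.neg_re,
    Complex.one_re] at this
  linarith

theorem eis_re (p : Eisenstein) : (eis p).re = p.re - p.im / 2 := by
  simp only [eis_apply, Complex.add_re, Complex.mul_re, Complex.intCast_re, Complex.intCast_im,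
    v_re]
  ring

theorem v_im_ne_zero : v.im ≠ 0 := by
  intro h
  have := congrArg Complex.re v_sq
  simp only [sq, Complex.mul_re, h, v_re, Complex.sub_re, Complex.neg_re, Complex.one_re] at this
  norm_num at this

theorem eis_injective : Function.Injective eis := by
  refine (injective_iff_map_eq_zero eis).2 fun p hp => ?_
  rw [eis_apply] at hp
  have him : (p.im : ℝ) = 0 := by simpa [v_im_ne_zero] using congrArg Complex.im hp
  have hre : (p.re : ℝ) = 0 := by simpa [him] using congrArg Complex.re hp
  exact QuadraticAlgebra.ext (mod_cast hre) (mod_cast him)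

theorem star_eis (p : Eisenstein) : star (eis p) = eis (star p) := by
  simp only [eis_apply, star_add, star_mul', star_v, w, v_sq, star_intCast,
    QuadraticAlgebra.re_star, QuadraticAlgebra.im_star]
  push_cast
  ring

theorem residue_star (p : Eisenstein) : residue (star p) = residue p := by
  have h3 : (3 : ZMod 3) = 0 := by decide
  simp only [residue_apply, QuadraticAlgebra.re_star, QuadraticAlgebra.im_star]
  push_cast
  linear_combination (-p.im : ZMod 3) * h3

theorem eis_omega : eis ω = v := by simp [eis_apply]

theorem eis_omega_sq : eis (ω ^ 2) = w := by rw [map_pow, eis_omega, w]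

theorem eis_theta : eis theta = t := by
  simp only [eis_apply, theta, t, w, v_sq]
  push_cast
  ring

theorem star_t : star t = -t := by
  rw [t, star_sub, ← star_v, star_star]
  ring

theorem t_mul_t : t * t = -3 := by
  rw [← eis_theta, ← map_mul, show theta * theta = -3 by decide, map_neg, map_ofNat]

theorem t_ne_zero : t ≠ 0 := left_ne_zero_of_mul (t_mul_t.trans_ne (neg_ne_zero.2 three_ne_zero))

theorem v_ne_w : v ≠ w := fun h => t_ne_zero (sub_eq_zero.2 h)

theorem theta_dvd_of_residue_eq_zero {p : Eisenstein} (hp : residue p = 0) : theta ∣ p := by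
  have h : ((p.re + p.im : ℤ) : ZMod 3) = 0 := by simpa [residue_apply] using hp
  obtain ⟨k, hk⟩ := (ZMod.intCast_zmod_eq_zero_iff_dvd _ 3).1 h
  refine ⟨⟨2 * k - p.re, k - p.re⟩, QuadraticAlgebra.ext ?_ ?_⟩ <;>
    simp only [theta, QuadraticAlgebra.re_mul, QuadraticAlgebra.im_mul] <;> push_cast at hk <;> lia

theorem eis_mul_star_self (p : Eisenstein) : eis (p * star p) = (p.norm : ℂ) := by
  rw [← QuadraticAlgebra.algebraMap_norm_eq_mul_star]
  simp

theorem norm_nonneg (p : Eisenstein) : 0 ≤ p.norm := by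
  rw [QuadraticAlgebra.norm_def]
  nlinarith [sq_nonneg (2 * p.re - p.im), sq_nonneg p.im]

theorem norm_eq_zero_iff {p : Eisenstein} : p.norm = 0 ↔ p = 0 := by
  refine ⟨fun h => ?_, fun h => by simp [h]⟩
  rw [QuadraticAlgebra.norm_def] at h
  have him : p.im = 0 := by nlinarith [sq_nonneg (2 * p.re - p.im), sq_nonneg p.im]
  have hre : p.re = 0 := by simpa [him] using h
  exact QuadraticAlgebra.ext hre him

theorem norm_eq_one_iff {p : Eisenstein} : p.norm = 1 ↔ p ^ 6 = 1 := by
  constructor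
  · intro h
    rw [QuadraticAlgebra.norm_def] at h
    obtain ⟨a, b⟩ := p
    have ha : -1 ≤ a ∧ a ≤ 1 := by constructor <;> nlinarith [sq_nonneg (2 * b - a)]
    have hb : -1 ≤ b ∧ b ≤ 1 := by constructor <;> nlinarith [sq_nonneg (2 * a - b)]
    obtain ⟨ha, ha'⟩ := ha
    obtain ⟨hb, hb'⟩ := hb
    interval_cases a <;> interval_cases b <;> revert h <;> decide
  · intro h
    have h6 : p.norm ^ 6 = 1 := by rw [← map_pow, h, map_one]
    exact (pow_eq_one_iff_of_nonneg (norm_nonneg p) (by norm_num)).1 h6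

theorem pow_six_eq_one_iff {R : Type*} [CommRing R] [NoZeroDivisors R] {u : R} :
    u ^ 6 = 1 ↔ u ^ 3 = 1 ∨ (-u) ^ 3 = 1 := by
  rw [show u ^ 6 = (u ^ 3) ^ 2 by ring, sq_eq_one_iff, Odd.neg_pow (by decide), neg_eq_iff_eq_neg]

theorem v_pow_six : v ^ 6 = 1 := pow_six_eq_one_iff.2 (.inl v_pow_three)

theorem exists_eis_pow_eq {u : ℂ} (hu : u ^ 3 = 1) : ∃ k : Fin 3, eis (ω ^ (k : ℕ)) = u := by
  obtain ⟨k, hk, rfl⟩ := isPrimitiveRoot_v.eq_pow_of_pow_eq_one hu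
  exact ⟨⟨k, hk⟩, by rw [map_pow, eis_omega]⟩

theorem exists_eis_eq {u : ℂ} (hu : u ^ 6 = 1) : ∃ p, eis p = u := by
  rcases pow_six_eq_one_iff.1 hu with h | h
  · exact (exists_eis_pow_eq h).imp' _ fun _ => id
  · obtain ⟨k, hk⟩ := exists_eis_pow_eq h
    exact ⟨-ω ^ (k : ℕ), by rw [map_neg, hk, neg_neg]⟩

theorem pow_three_eq_one_of_residue_eq_one {p : Eisenstein} (hp : p ^ 6 = 1)
    (hr : residue p = 1) : p ^ 3 = 1 := by
  have h6 : eis p ^ 6 = 1 := by rw [← map_pow, hp, map_one]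
  rcases pow_six_eq_one_iff.1 h6 with h | h
  · exact eis_injective (by rw [map_pow, h, map_one])
  · have h3 : (-p) ^ 3 = 1 := eis_injective (by rw [map_pow, map_neg, h, map_one])
    have := congrArg residue h3
    rw [map_pow, map_neg, hr, map_one] at this
    exact absurd this (by decide)

/-! ### The root lattice and its dual -/

theorem hdot_smul_left (z : ℂ) (x y : V) : hdot (z • x) y = z * hdot x y :=
  smul_dotProduct z x (star y)

theorem hdot_smul_right (z : ℂ) (x y : V) : hdot x (z • y) = star z * hdot x y :=
  (congrArg (dotProduct x) (star_smul z y)).trans (dotProduct_smul (star z) x (star y))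

theorem star_hdot (x y : V) : star (hdot x y) = hdot y x := by
  simp [hdot, mul_comm]

theorem hdot_single_right (x : V) (i : Fin 3) (z : ℂ) : hdot x (Pi.single i z) = x i * star z := by
  rw [hdot, Finset.sum_eq_single i] <;> simp +contextual

theorem hdot_eis (p q : Fin 3 → Eisenstein) :
    hdot (eis ∘ p) (eis ∘ q) = eis (∑ i, p i * star (q i)) := by
  simp [hdot, star_eis]

/-- The Euclidean inner product `Re(x · y)` of the real `6`-space. -/
def realForm : LinearMap.BilinForm ℝ V :=
  LinearMap.mk₂ ℝ (fun x y => (hdot x y).re)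
    (fun x y z => by simp [hdot, add_mul, Finset.sum_add_distrib])
    (fun c x y => by simp [hdot, Finset.mul_sum, mul_assoc])
    (fun x y z => by simp [hdot, mul_add, Finset.sum_add_distrib])
    (fun c x y => by simp [hdot, Finset.mul_sum, mul_left_comm, mul_add])

theorem realForm_apply (x y : V) : realForm x y = (hdot x y).re := rfl

theorem realForm_isSymm : realForm.IsSymm :=
  ⟨fun x y => by rw [realForm_apply, realForm_apply, ← star_hdot]; simp⟩

theorem realForm_self (x : V) : realForm x x = ∑ i, ‖x i‖ ^ 2 := by
  simp [realForm_apply, hdot, Complex.mul_conj, Complex.normSq_eq_norm_sq, -Complex.ofReal_pow]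

theorem realForm_eis_self (p : Fin 3 → Eisenstein) :
    realForm (eis ∘ p) (eis ∘ p) = (∑ i, (p i).norm : ℤ) := by
  rw [realForm_apply, hdot_eis, map_sum]
  simp [eis_mul_star_self]

theorem realForm_smul_smul {u : ℂ} (hu : star u * u = 1) (x y : V) :
    realForm (u • x) (u • y) = realForm x y := by
  rw [realForm_apply, hdot_smul_left, hdot_smul_right, ← mul_assoc, mul_comm u, hu, one_mul,
    realForm_apply]

/-- The lattice spanned by the roots: vectors of Eisenstein integers whose entries are congruent
modulo `√-3`. -/
def rootLattice : AddSubgroup V where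
  carrier := {x | ∃ p : Fin 3 → Eisenstein, (∀ i, residue (p i) = residue (p 0)) ∧ eis ∘ p = x}
  zero_mem' := ⟨0, fun _ => rfl, by ext; simp⟩
  add_mem' := by
    rintro _ _ ⟨p, hp, rfl⟩ ⟨q, hq, rfl⟩
    exact ⟨p + q, fun i => by simp [hp i, hq i], by ext; simp⟩
  neg_mem' := by
    rintro _ ⟨p, hp, rfl⟩
    exact ⟨-p, fun i => by simp [hp i], by ext; simp⟩

/-- The lattice dual to `rootLattice` with respect to `2/3 Re(x · y)`: vectors of Eisenstein
integers whose sum of entries is divisible by `√-3`. -/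
def weightLattice : AddSubgroup V where
  carrier := {x | ∃ p : Fin 3 → Eisenstein, residue (∑ i, p i) = 0 ∧ eis ∘ p = x}
  zero_mem' := ⟨0, by simp, by ext; simp⟩
  add_mem' := by
    rintro _ _ ⟨p, hp, rfl⟩ ⟨q, hq, rfl⟩
    exact ⟨p + q, by simp [Finset.sum_add_distrib, hp, hq], by ext; simp⟩
  neg_mem' := by
    rintro _ ⟨p, hp, rfl⟩
    exact ⟨-p, by simp [hp], by ext; simp⟩

theorem rootLattice_le_weightLattice : rootLattice ≤ weightLattice := by
  rintro _ ⟨p, hp, rfl⟩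
  refine ⟨p, ?_, rfl⟩
  have h3 : (3 : ZMod 3) = 0 := by decide
  rw [map_sum, Finset.sum_congr rfl fun i _ => hp i]
  simp [h3]

theorem eis_smul_comp (u : Eisenstein) (p : Fin 3 → Eisenstein) :
    eis u • (eis ∘ p) = eis ∘ (u • p) := by
  ext; simp

theorem eis_smul_mem_rootLattice (u : Eisenstein) {x : V} (hx : x ∈ rootLattice) :
    eis u • x ∈ rootLattice := by
  obtain ⟨p, hp, rfl⟩ := hx
  exact ⟨u • p, fun i => by simp [hp i], (eis_smul_comp u p).symm⟩

theorem exists_two_mul_realForm_eq {x y : V} (hx : x ∈ weightLattice) (hy : y ∈ rootLattice) :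
    ∃ n : ℤ, 2 * realForm x y = 3 * n := by
  obtain ⟨p, hp, rfl⟩ := hx
  obtain ⟨q, hq, rfl⟩ := hy
  have h : residue (∑ i, p i * star (q i)) = 0 := by
    simp only [map_sum, map_mul, residue_star, hq, ← Finset.sum_mul]
    rw [← map_sum, hp, zero_mul]
  obtain ⟨z, hz⟩ := theta_dvd_of_residue_eq_zero h
  refine ⟨-z.im, ?_⟩
  rw [realForm_apply, hdot_eis, hz, eis_re]
  simp only [theta, QuadraticAlgebra.re_mul, QuadraticAlgebra.im_mul]
  push_cast
  ring

/-! ### The roots -/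

theorem eis_comp_vec3 (p q r : Eisenstein) : eis ∘ ![p, q, r] = ![eis p, eis q, eis r] := by
  ext i
  fin_cases i <;> rfl

/-- Eisenstein coordinates of the twelve vectors in `mirrorVectors`, in the same order. -/
def mirrorCoords : Fin 12 → Fin 3 → Eisenstein :=
  ![![theta, 0, 0], ![1, 1, 1], ![ω, 1, 1], ![ω ^ 2, 1, 1],
    ![0, theta, 0], ![1, ω, ω ^ 2], ![1, 1, ω], ![1, ω ^ 2, 1],
    ![0, 0, theta], ![1, ω ^ 2, ω], ![1, ω, 1], ![1, 1, ω ^ 2]]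

theorem mirrorVectors_eq_range : mirrorVectors = Set.range fun n => eis ∘ mirrorCoords n := by
  ext x
  simp [mirrorVectors, mirrorCoords, Fin.exists_fin_succ, eis_comp_vec3, eis_theta, eis_omega,
    eis_omega_sq, eq_comm (b := x), -map_pow]

theorem residue_mirrorCoords_and_sum_norm : ∀ n : Fin 12,
    (∀ i, residue (mirrorCoords n i) = residue (mirrorCoords n 0)) ∧
      ∑ i, (mirrorCoords n i).norm = 3 := by
  decide +kernel

theorem pow_vec_eq_smul_mirrorCoords : ∀ k : Fin 3 → Fin 3, ∃ (n : Fin 12) (l : Fin 3),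
    (fun i => ω ^ (k i : ℕ) : Fin 3 → Eisenstein) =
      (ω ^ (l : ℕ) : Eisenstein) • mirrorCoords n := by
  decide +kernel

theorem smul_mem_realRoots {u : ℂ} (hu : u ^ 6 = 1) {a : V} (ha : a ∈ realRoots) :
    u • a ∈ realRoots := by
  obtain ⟨r, hr, z, hz, rfl⟩ := ha
  exact ⟨r, hr, u * z, by rw [mul_pow, hu, hz, one_mul], smul_smul u z r⟩

theorem neg_mem_realRoots {a : V} (ha : a ∈ realRoots) : -a ∈ realRoots :=
  neg_one_smul ℂ a ▸ smul_mem_realRoots (by norm_num) ha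

theorem mirrorVectors_subset_realRoots : mirrorVectors ⊆ realRoots :=
  fun r hr => ⟨r, hr, 1, one_pow 6, (one_smul ℂ r).symm⟩

theorem mem_rootLattice_and_realForm_of_mem_realRoots {a : V} (ha : a ∈ realRoots) :
    a ∈ rootLattice ∧ realForm a a = 3 := by
  obtain ⟨r, hr, u, hu, rfl⟩ := ha
  obtain ⟨n, rfl⟩ := mirrorVectors_eq_range ▸ hr
  obtain ⟨q, rfl⟩ := exists_eis_eq hu
  obtain ⟨hres, hnorm⟩ := residue_mirrorCoords_and_sum_norm n
  refine ⟨eis_smul_mem_rootLattice q ⟨_, hres, rfl⟩, ?_⟩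
  rw [realForm_smul_smul (star_mul_self_of_pow_eq_one hu), realForm_eis_self, hnorm, Int.cast_ofNat]

theorem mem_realRoots_of_pow_three {c : V} (hc : c ^ 3 = 1) : c ∈ realRoots := by
  choose k hk using fun i => exists_eis_pow_eq (congrFun hc i)
  obtain ⟨n, l, hl⟩ := pow_vec_eq_smul_mirrorCoords k
  have h6 : eis (ω ^ (l : ℕ)) ^ 6 = 1 := by
    rw [map_pow, eis_omega, pow_right_comm, v_pow_six, one_pow]
  have hn : eis ∘ mirrorCoords n ∈ mirrorVectors := mirrorVectors_eq_range ▸ Set.mem_range_self n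
  refine ⟨_, hn, _, h6, ?_⟩
  rw [eis_smul_comp, ← hl]
  exact funext fun i => (hk i).symm

theorem single_mem_mirrorVectors (i : Fin 3) : (Pi.single i t : V) ∈ mirrorVectors := by
  rw [mirrorVectors_eq_range]
  refine ⟨![0, 4, 8] i, ?_⟩
  fin_cases i <;> ext j <;> fin_cases j <;> simp [mirrorCoords, eis_theta]

theorem single_mem_realRoots (i : Fin 3) : (Pi.single i t : V) ∈ realRoots :=
  mirrorVectors_subset_realRoots (single_mem_mirrorVectors i)

theorem single_mul_t (i : Fin 3) (z : ℂ) : (Pi.single i (z * t) : V) = z • Pi.single i t := by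
  rw [← Pi.single_smul, smul_eq_mul]

theorem exists_eq_one_of_sum_eq_one {ι : Type*} [Fintype ι] {f : ι → ℤ} (hf : ∀ i, 0 ≤ f i)
    (h : ∑ i, f i = 1) : ∃ i, f i = 1 ∧ ∀ j ≠ i, f j = 0 := by
  classical
  obtain ⟨i, -, hi⟩ := Finset.exists_ne_zero_of_sum_ne_zero (h.trans_ne one_ne_zero)
  have hsum := Finset.add_sum_erase Finset.univ f (Finset.mem_univ i)
  have hrest : 0 ≤ ∑ j ∈ Finset.univ.erase i, f j := Finset.sum_nonneg fun j _ => hf j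
  have hi1 : f i = 1 := by have := hf i; lia
  refine ⟨i, hi1, fun j hj => ?_⟩
  refine (Finset.sum_eq_zero_iff_of_nonneg fun j _ => hf j).1 ?_ j
    (Finset.mem_erase.2 ⟨hj, Finset.mem_univ j⟩)
  lia

theorem exists_eq_single_of_residue_eq_zero {p : Fin 3 → Eisenstein} (hp : ∀ i, residue (p i) = 0)
    (h : ∑ i, (p i).norm = 3) : ∃ i u, u ^ 6 = 1 ∧ eis ∘ p = Pi.single i (u * t) := by
  choose q hq using fun i => theta_dvd_of_residue_eq_zero (hp i)
  have hnorm : ∀ i, (p i).norm = 3 * (q i).norm := fun i => by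
    rw [hq i, map_mul]; rfl
  have hsum : ∑ i, (q i).norm = 1 := by
    simp only [hnorm, ← Finset.mul_sum] at h
    lia
  obtain ⟨i, hi, hj⟩ := exists_eq_one_of_sum_eq_one (fun i => norm_nonneg (q i)) hsum
  refine ⟨i, eis (q i), by rw [← map_pow, norm_eq_one_iff.1 hi, map_one], funext fun j => ?_⟩
  rcases eq_or_ne j i with rfl | hji
  · rw [Pi.single_eq_same, Function.comp_apply, hq, map_mul, eis_theta, mul_comm]
  · rw [Pi.single_eq_of_ne hji, Function.comp_apply, hq, norm_eq_zero_iff.1 (hj j hji), mul_zero,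
      map_zero]

theorem pow_three_or_neg_pow_three_of_residue_ne_zero {p : Fin 3 → Eisenstein}
    (hp : ∀ i, residue (p i) = residue (p 0)) (h0 : residue (p 0) ≠ 0)
    (h : ∑ i, (p i).norm = 3) : p ^ 3 = 1 ∨ (-p) ^ 3 = 1 := by
  have hpos : ∀ i, 0 < (p i).norm := fun i =>
    (norm_nonneg (p i)).lt_of_ne' fun hi => h0 <| by
      rw [← hp i, norm_eq_zero_iff.1 hi, map_zero]
  have h6 : ∀ i, p i ^ 6 = 1 := by
    rw [Fin.sum_univ_three] at h
    refine fun i => norm_eq_one_iff.1 ?_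
    have := hpos 0; have := hpos 1; have := hpos 2
    fin_cases i <;> dsimp only [Fin.zero_eta, Fin.mk_one, Fin.reduceFinMk] <;> lia
  have hunit : ∀ r : ZMod 3, r ≠ 0 → r = 1 ∨ r = -1 := by decide
  rcases hunit _ h0 with h1 | h1
  · exact .inl <| funext fun i => pow_three_eq_one_of_residue_eq_one (h6 i) ((hp i).trans h1)
  · refine .inr <| funext fun i => pow_three_eq_one_of_residue_eq_one ?_ ?_
    · rw [Pi.neg_apply, Even.neg_pow (by decide), h6 i]
    · rw [Pi.neg_apply, map_neg, hp i, h1, neg_neg]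

theorem exists_of_mem_rootLattice_of_realForm_eq {a : V} (ha : a ∈ rootLattice)
    (h3 : realForm a a = 3) :
    (a ^ 3 = 1 ∨ (-a) ^ 3 = 1) ∨ ∃ i u, u ^ 6 = 1 ∧ a = Pi.single i (u * t) := by
  obtain ⟨p, hp, rfl⟩ := ha
  rw [realForm_eis_self] at h3
  have hsum : ∑ i, (p i).norm = 3 := mod_cast h3
  by_cases h0 : residue (p 0) = 0
  · exact .inr (exists_eq_single_of_residue_eq_zero (fun i => (hp i).trans h0) hsum)
  · refine .inl ((pow_three_or_neg_pow_three_of_residue_ne_zero hp h0 hsum).imp ?_ ?_) <;>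
    · intro h
      ext i
      simpa using congrArg eis (congrFun h i)

theorem mem_realRoots_iff {a : V} : a ∈ realRoots ↔
    (a ^ 3 = 1 ∨ (-a) ^ 3 = 1) ∨ ∃ i u, u ^ 6 = 1 ∧ a = Pi.single i (u * t) := by
  refine ⟨fun ha => ?_, ?_⟩
  · obtain ⟨ha, h3⟩ := mem_rootLattice_and_realForm_of_mem_realRoots ha
    exact exists_of_mem_rootLattice_of_realForm_eq ha h3
  · rintro ((h | h) | ⟨i, u, hu, rfl⟩)
    · exact mem_realRoots_of_pow_three h
    · simpa using neg_mem_realRoots (mem_realRoots_of_pow_three h)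
    · exact single_mul_t i u ▸ smul_mem_realRoots hu (single_mem_realRoots i)

theorem mem_realRoots_iff_mem_rootLattice {a : V} :
    a ∈ realRoots ↔ a ∈ rootLattice ∧ realForm a a = 3 :=
  ⟨mem_rootLattice_and_realForm_of_mem_realRoots, fun h =>
    mem_realRoots_iff.2 (exists_of_mem_rootLattice_of_realForm_eq h.1 h.2)⟩

/-! ### The group generated by the real reflections -/

/-- The orthogonal reflection of the real `6`-space that negates `a`. -/
abbrev realReflection (a : V) : V ≃ₗ[ℝ] V := orthogonalReflection realForm a

theorem realReflections_eq_image : realReflections = realReflection '' realRoots := by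
  ext s
  refine exists_congr fun a => and_congr_right fun _ => ?_
  rw [eq_comm, LinearEquiv.ext_iff]
  simp_rw [orthogonalReflection_apply, realForm_apply]

theorem realReflection_mem {a : V} (ha : a ∈ realRoots) :
    realReflection a ∈ realReflectionGroup :=
  Subgroup.subset_closure (realReflections_eq_image ▸ Set.mem_image_of_mem _ ha)

theorem realForm_self_of_mem {a : V} (ha : a ∈ realRoots) : realForm a a = 3 :=
  (mem_realRoots_iff_mem_rootLattice.1 ha).2

theorem realForm_self_ne_zero_of_mem {a : V} (ha : a ∈ realRoots) : realForm a a ≠ 0 :=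
  (realForm_self_of_mem ha).trans_ne three_ne_zero

theorem ne_zero_of_mem_realRoots {a : V} (ha : a ∈ realRoots) : a ≠ 0 := by
  rintro rfl
  exact realForm_self_ne_zero_of_mem ha (map_zero _)

@[elab_as_elim]
theorem realReflectionGroup_induction {p : ∀ g, g ∈ realReflectionGroup → Prop}
    (one : p 1 (one_mem _))
    (mul : ∀ a (ha : a ∈ realRoots) g hg, p g hg →
      p (realReflection a * g) (mul_mem (realReflection_mem ha) hg))
    {g : V ≃ₗ[ℝ] V} (hg : g ∈ realReflectionGroup) : p g hg := by
  induction hg using Subgroup.closure_induction_left with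
  | one => exact one
  | mul_left s hs g hg ih =>
    obtain ⟨a, ha, rfl⟩ := realReflections_eq_image ▸ hs
    exact mul a ha g hg ih
  | inv_mul_cancel s hs g hg ih =>
    obtain ⟨a, ha, rfl⟩ := realReflections_eq_image ▸ hs
    simpa only [orthogonalReflection_inv] using mul a ha g hg ih

theorem realForm_map_map {g : V ≃ₗ[ℝ] V} (hg : g ∈ realReflectionGroup) (x y : V) :
    realForm (g x) (g y) = realForm x y := by
  induction hg using realReflectionGroup_induction with
  | one => rfl
  | mul a ha g _ ih =>
    exact (apply_orthogonalReflection realForm_isSymm (realForm_self_ne_zero_of_mem ha) _ _).trans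
      ih

theorem realReflection_sub_self_mem {a x : V} (ha : a ∈ realRoots) (hx : x ∈ weightLattice) :
    realReflection a x - x ∈ rootLattice := by
  obtain ⟨haΛ, ha3⟩ := mem_realRoots_iff_mem_rootLattice.1 ha
  obtain ⟨n, hn⟩ := exists_two_mul_realForm_eq hx haΛ
  rw [orthogonalReflection_apply, hn, ha3, mul_div_cancel_left₀ _ three_ne_zero,
    sub_sub_cancel_left, Int.cast_smul_eq_zsmul]
  exact neg_mem (zsmul_mem haΛ n)

theorem apply_sub_self_mem_rootLattice {g : V ≃ₗ[ℝ] V} (hg : g ∈ realReflectionGroup) {x : V}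
    (hx : x ∈ weightLattice) : g x - x ∈ rootLattice := by
  induction hg using realReflectionGroup_induction with
  | one => simp
  | mul a ha g _ ih =>
    have hgx : g x ∈ weightLattice := by
      simpa using add_mem (rootLattice_le_weightLattice ih) hx
    rw [LinearEquiv.mul_apply, ← sub_add_sub_cancel]
    exact add_mem (realReflection_sub_self_mem ha hgx) ih

theorem apply_mem_realRoots {g : V ≃ₗ[ℝ] V} (hg : g ∈ realReflectionGroup) {a : V}
    (ha : a ∈ realRoots) : g a ∈ realRoots := by
  obtain ⟨haΛ, ha3⟩ := mem_realRoots_iff_mem_rootLattice.1 ha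
  refine mem_realRoots_iff_mem_rootLattice.2 ⟨?_, by rw [realForm_map_map hg, ha3]⟩
  simpa using add_mem (apply_sub_self_mem_rootLattice hg (rootLattice_le_weightLattice haΛ)) haΛ

theorem det_realReflection {a : V} (ha : a ∈ realRoots) :
    LinearEquiv.det (realReflection a) = -1 :=
  det_orthogonalReflection (realForm_self_ne_zero_of_mem ha)

theorem realReflection_single (i : Fin 3) (x : V) :
    realReflection (Pi.single i t) x = Function.update x i (star (x i)) := by
  have hre : ((2 * realForm x (Pi.single i t) : ℝ) : ℂ) = t * (star (x i) - x i) := by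
    rw [realForm_apply, hdot_single_right, ← Complex.add_conj, ← Complex.star_def, star_mul',
      star_star, star_t]
    ring
  rw [orthogonalReflection_apply, realForm_self_of_mem (single_mem_realRoots i)]
  ext j
  rcases eq_or_ne j i with rfl | hj
  · rw [Function.update_self, Pi.sub_apply, Pi.smul_apply, Pi.single_eq_same, Complex.real_smul,
      Complex.ofReal_div, hre, Complex.ofReal_ofNat]
    linear_combination (-(star (x j) - x j) / 3) * t_mul_t
  · simp [hj]

/-! ### Generators of the Hessian group -/

theorem realify_injective : Function.Injective realify := fun _ _ hgh =>
  Units.ext <| Matrix.ext_of_mulVec_single fun i => LinearEquiv.congr_fun hgh (Pi.single i 1)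

theorem realify_smul (g : GL (Fin 3) ℂ) (z : ℂ) (x : V) : realify g (z • x) = z • realify g x :=
  Matrix.mulVec_smul (g : Matrix (Fin 3) (Fin 3) ℂ) z x

/-- The invertible diagonal matrices. -/
def diagGL : Vˣ →* GL (Fin 3) ℂ := Units.map (Matrix.diagonalRingHom (Fin 3) ℂ).toMonoidHom

theorem coe_diagGL (c : Vˣ) : (diagGL c : Matrix (Fin 3) (Fin 3) ℂ) = Matrix.diagonal c := rfl

theorem realify_diagGL (c : Vˣ) (x : V) : realify (diagGL c) x = c * x :=
  funext fun i => Matrix.mulVec_diagonal (c : V) x i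

/-- A vector of cube roots of unity as a unit of `ℂ × ℂ × ℂ`. -/
def cubeUnit (c : V) (hc : c ^ 3 = 1) : Vˣ := Units.ofPowEqOne c 3 hc three_ne_zero

theorem coe_cubeUnit (c : V) (hc : c ^ 3 = 1) : (cubeUnit c hc : V) = c := rfl

theorem cubeUnit_pow_three (c : V) (hc : c ^ 3 = 1) : cubeUnit c hc ^ 3 = 1 := Units.ext hc

theorem w_pow_three : w ^ 3 = 1 := by rw [w, pow_right_comm, v_pow_three, one_pow]

theorem pow_three_eq_one_of_mem_pair {lam : ℂ} (hlam : lam ∈ ({v, w} : Set ℂ)) : lam ^ 3 = 1 := by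
  rcases hlam with rfl | rfl
  exacts [v_pow_three, w_pow_three]

theorem mulSingle_pow_three (i : Fin 3) {z : ℂ} (hz : z ^ 3 = 1) :
    (Pi.mulSingle i z : V) ^ 3 = 1 := by
  rw [← Pi.mulSingle_pow, hz, Pi.mulSingle_one]

theorem diagGL_mem_of_forall_mulSingle_mem {K : Subgroup (GL (Fin 3) ℂ)}
    (hK : ∀ i, diagGL (cubeUnit (Pi.mulSingle i v) (mulSingle_pow_three i v_pow_three)) ∈ K)
    {c : Vˣ} (hc : c ^ 3 = 1) : diagGL c ∈ K := by
  have hc3 : ∀ i, (c : V) i ^ 3 = 1 := fun i => congrFun (congrArg Units.val hc) i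
  choose k _ hk using fun i => isPrimitiveRoot_v.eq_pow_of_pow_eq_one (hc3 i)
  have hprod : c = ∏ i, cubeUnit (Pi.mulSingle i v) (mulSingle_pow_three i v_pow_three) ^ k i := by
    ext j
    simp only [Units.coe_prod, Units.val_pow_eq_pow_val, coe_cubeUnit, ← Pi.mulSingle_pow, hk,
      Finset.univ_prod_mulSingle]
  rw [hprod, ← Subgroup.mem_comap]
  exact Subgroup.prod_mem _ fun i _ => pow_mem (Subgroup.mem_comap.2 (hK i)) _

/-- The cyclic permutation of coordinates. -/
def shiftGL : GL (Fin 3) ℂ :=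
  Matrix.GeneralLinearGroup.mkOfDetNeZero g27b (by rw [det_g27b]; exact one_ne_zero)

/-- The discrete Fourier transform. -/
def fourierGL : GL (Fin 3) ℂ :=
  Matrix.GeneralLinearGroup.mkOfDetNeZero q8a (by rw [det_q8a]; exact one_ne_zero)

theorem realify_shiftGL (x : V) : realify shiftGL x = ![x 1, x 2, x 0] := by
  ext i
  fin_cases i <;> simp [realify, shiftGL, Matrix.GeneralLinearGroup.mkOfDetNeZero, g27b,
    dotProduct, Fin.sum_univ_three]

theorem realify_fourierGL (x : V) : realify fourierGL x = (-t / 3) •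
    ![x 0 + x 1 + x 2, x 0 + v * x 1 + w * x 2, x 0 + w * x 1 + v * x 2] := by
  ext i
  fin_cases i <;> simp [realify, fourierGL, Matrix.GeneralLinearGroup.mkOfDetNeZero, q8a,
    dotProduct, Fin.sum_univ_three] <;> ring

theorem vec3_pow_three {a b c : ℂ} (ha : a ^ 3 = 1) (hb : b ^ 3 = 1) (hc : c ^ 3 = 1) :
    (![a, b, c] : V) ^ 3 = 1 := by
  ext i
  fin_cases i <;> assumption

theorem vec3_mul (a b c : ℂ) (x : V) : ![a, b, c] * x = ![a * x 0, b * x 1, c * x 2] := by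
  ext i
  fin_cases i <;> rfl

theorem fourierGL_mul_shiftGL : fourierGL * shiftGL =
    diagGL (cubeUnit ![1, w, v] (vec3_pow_three (one_pow 3) w_pow_three v_pow_three)) *
      fourierGL := by
  refine realify_injective (LinearEquiv.ext fun x => ?_)
  simp only [map_mul, LinearEquiv.mul_apply, realify_diagGL, realify_shiftGL, realify_fourierGL,
    coe_cubeUnit, vec3_mul]
  have h := v_sq
  ext i
  fin_cases i <;> simp [w] <;> grind

theorem q8bGL_eq : Matrix.GeneralLinearGroup.mkOfDetNeZero q8b
      (by rw [det_q8b]; exact one_ne_zero) =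
    diagGL (cubeUnit ![1, w, w] (vec3_pow_three (one_pow 3) w_pow_three w_pow_three)) * fourierGL *
      diagGL (cubeUnit ![1, v, v] (vec3_pow_three (one_pow 3) v_pow_three v_pow_three)) := by
  apply Units.ext
  ext i j
  simp only [Units.val_mul, coe_diagGL, coe_cubeUnit, Matrix.mul_diagonal, Matrix.diagonal_mul]
  have h := v_sq
  fin_cases i <;> fin_cases j <;>
    simp [Matrix.GeneralLinearGroup.mkOfDetNeZero, fourierGL, q8a, q8b, w] <;> grind

theorem hessianGroup_le {K : Subgroup (GL (Fin 3) ℂ)} (hd : ∀ c : Vˣ, c ^ 3 = 1 → diagGL c ∈ K)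
    (hf : fourierGL ∈ K) : hessianGroup ≤ K := by
  have h1 := one_pow (M := ℂ) 3
  have hdiag : ∀ (g : GL (Fin 3) ℂ) (c : V), c ^ 3 = 1 →
      (g : Matrix (Fin 3) (Fin 3) ℂ) = Matrix.diagonal c → g ∈ K := fun g c hc h => by
    rw [show g = diagGL (cubeUnit c hc) from Units.ext h]
    exact hd _ (cubeUnit_pow_three c hc)
  rw [hessianGroup, Subgroup.closure_le]
  rintro g (rfl | rfl | rfl | rfl | rfl)
  · refine hdiag _ ![1, v, w] (vec3_pow_three h1 v_pow_three w_pow_three) (Matrix.ext fun i j => ?_)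
    fin_cases i <;> fin_cases j <;> rfl
  · refine (mul_mem_cancel_left hf).1 (?_ : fourierGL * shiftGL ∈ K)
    rw [fourierGL_mul_shiftGL]
    exact mul_mem (hd _ (cubeUnit_pow_three _ _)) hf
  · exact hf
  · change _ ∈ K
    rw [q8bGL_eq]
    exact mul_mem (mul_mem (hd _ (cubeUnit_pow_three _ _)) hf) (hd _ (cubeUnit_pow_three _ _))
  · refine hdiag _ ![v, 1, 1] (vec3_pow_three v_pow_three h1 h1) (Matrix.ext fun i j => ?_)
    fin_cases i <;> fin_cases j <;> rfl

theorem shiftGL_mem : shiftGL ∈ hessianGroup := Subgroup.subset_closure (.inr (.inl rfl))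

theorem fourierGL_mem : fourierGL ∈ hessianGroup :=
  Subgroup.subset_closure (.inr (.inr (.inl rfl)))

theorem shiftGL_mul_diagGL (i : Fin 3) :
    shiftGL * diagGL (cubeUnit (Pi.mulSingle (i + 1) v) (mulSingle_pow_three _ v_pow_three)) =
      diagGL (cubeUnit (Pi.mulSingle i v) (mulSingle_pow_three i v_pow_three)) * shiftGL := by
  refine realify_injective (LinearEquiv.ext fun x => ?_)
  simp only [map_mul, LinearEquiv.mul_apply, realify_diagGL, realify_shiftGL, coe_cubeUnit]
  ext j
  fin_cases i <;> fin_cases j <;> simp [Pi.mulSingle, Function.update]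

theorem diagGL_mem {c : Vˣ} (hc : c ^ 3 = 1) : diagGL c ∈ hessianGroup := by
  refine diagGL_mem_of_forall_mulSingle_mem (fun i => ?_) hc
  have hsucc : ∀ i : Fin 3,
      diagGL (cubeUnit (Pi.mulSingle (i + 1) v) (mulSingle_pow_three _ v_pow_three)) ∈
        hessianGroup →
      diagGL (cubeUnit (Pi.mulSingle i v) (mulSingle_pow_three i v_pow_three)) ∈
        hessianGroup := fun i hi => by
    rw [← mul_mem_cancel_right shiftGL_mem, ← shiftGL_mul_diagGL]
    exact mul_mem shiftGL_mem hi
  have h0 : diagGL (cubeUnit (Pi.mulSingle 0 v) (mulSingle_pow_three 0 v_pow_three)) ∈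
      hessianGroup := by
    refine Subgroup.subset_closure (.inr (.inr (.inr (.inr ?_))))
    refine Units.ext (Matrix.ext fun i j => ?_)
    fin_cases i <;> fin_cases j <;> rfl
  fin_cases i
  exacts [h0, hsucc 1 (hsucc 2 h0), hsucc 2 h0]

/-! ### Complex reflections -/

/-- The unitary reflection with root `r` that multiplies `r` by `lam`. -/
def unitaryReflection (r : V) (lam : ℂ) (x : V) : V :=
  x - (hdot x r / hdot r r * (1 - lam)) • r

theorem mem_complexReflections_iff {g : GL (Fin 3) ℂ} : g ∈ complexReflections ↔
    ∃ r ∈ mirrorVectors, ∃ lam ∈ ({v, w} : Set ℂ), ⇑(realify g) = unitaryReflection r lam := by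
  refine exists_congr fun r => and_congr_right fun _ => exists_congr fun lam =>
    and_congr_right fun _ => ?_
  exact Iff.symm funext_iff

theorem unitaryReflection_single (i : Fin 3) (lam : ℂ) (x : V) :
    unitaryReflection (Pi.single i t) lam x = Pi.mulSingle i lam * x := by
  rw [unitaryReflection, hdot_single_right, hdot_single_right, Pi.single_eq_same, star_t]
  ext j
  rcases eq_or_ne j i with rfl | hj
  · have ht := t_ne_zero
    simp only [Pi.sub_apply, Pi.smul_apply, Pi.single_eq_same, smul_eq_mul, Pi.mul_apply,
      Pi.mulSingle_eq_same]
    field_simp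
    ring
  · simp [hj]

theorem fourierGL_mem_closure_complexReflections
    (hd : ∀ c : Vˣ, c ^ 3 = 1 → diagGL c ∈ Subgroup.closure complexReflections) :
    fourierGL ∈ Subgroup.closure complexReflections := by
  let c := cubeUnit ![v, w, w] (vec3_pow_three v_pow_three w_pow_three w_pow_three)
  let d := cubeUnit ![1, v, v] (vec3_pow_three (one_pow 3) v_pow_three v_pow_three)
  have hrefl : ⇑(realify (diagGL c * fourierGL * diagGL d)) = unitaryReflection ![1, 1, 1] v := by
    ext x i
    simp only [map_mul, LinearEquiv.mul_apply, realify_diagGL, realify_fourierGL, c, d,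
      coe_cubeUnit, vec3_mul, unitaryReflection]
    have h := v_sq
    fin_cases i <;> simp [hdot, Fin.sum_univ_three, w, t] <;> grind
  have hmem : diagGL c * fourierGL * diagGL d ∈ Subgroup.closure complexReflections :=
    Subgroup.subset_closure <| mem_complexReflections_iff.2
      ⟨_, .inr (.inl rfl), v, .inl rfl, hrefl⟩
  rwa [mul_mem_cancel_right (hd _ (cubeUnit_pow_three _ _)),
    mul_mem_cancel_left (hd _ (cubeUnit_pow_three _ _))] at hmem

theorem hessianGroup_le_closure_complexReflections :
    hessianGroup ≤ Subgroup.closure complexReflections := by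
  have hd : ∀ c : Vˣ, c ^ 3 = 1 → diagGL c ∈ Subgroup.closure complexReflections := fun c hc =>
    diagGL_mem_of_forall_mulSingle_mem (fun i => Subgroup.subset_closure <|
      mem_complexReflections_iff.2 ⟨_, single_mem_mirrorVectors i, v, .inl rfl, funext fun x => by
        rw [unitaryReflection_single, realify_diagGL, coe_cubeUnit]⟩) hc
  exact hessianGroup_le hd (fourierGL_mem_closure_complexReflections hd)

theorem hdot_sub_left (x y r : V) : hdot (x - y) r = hdot x r - hdot y r :=
  sub_dotProduct x y (star r)

theorem hdot_self_of_mem {a : V} (ha : a ∈ realRoots) : hdot a a = 3 := by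
  have hre : (hdot a a).re = 3 := realForm_self_of_mem ha
  rw [← Complex.conj_eq_iff_re.1 (star_hdot a a), hre, Complex.ofReal_ofNat]

theorem realReflection_smul_apply {r : V} (hr : r ∈ realRoots) {u : ℂ} (hu : star u * u = 1)
    (x : V) : realReflection (u • r) x = x - ((hdot x r + u ^ 2 * star (hdot x r)) / 3) • r := by
  have hre : ((2 * realForm x (u • r) : ℝ) : ℂ) = star u * hdot x r + u * star (hdot x r) := by
    rw [realForm_apply, hdot_smul_right, ← Complex.add_conj, ← Complex.star_def, star_mul',
      star_star]
  rw [orthogonalReflection_apply, realForm_smul_smul hu, realForm_self_of_mem hr,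
    ← Complex.coe_smul, Complex.ofReal_div, hre, smul_smul, Complex.ofReal_ofNat]
  congr 2
  linear_combination hdot x r / 3 * hu

theorem realReflection_smul_mul {r : V} (hr : r ∈ realRoots) {u : ℂ} (hu : star u * u = 1) :
    ⇑(realReflection (u • r) * realReflection r) = unitaryReflection r (u ^ 2) := by
  ext1 x
  have hrefl := realReflection_smul_apply hr (u := 1) (by simp) x
  rw [one_smul, one_pow, one_mul] at hrefl
  have hdot_refl : hdot (realReflection r x) r = -star (hdot x r) := by
    rw [hrefl, hdot_sub_left, hdot_smul_left, hdot_self_of_mem hr]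
    ring
  rw [LinearEquiv.mul_apply, realReflection_smul_apply hr hu, hdot_refl, hrefl, unitaryReflection,
    hdot_self_of_mem hr, star_neg, star_star, sub_sub, ← add_smul]
  congr 2
  ring

theorem exists_realify_eq_mul_of_mem {g : GL (Fin 3) ℂ} (hg : g ∈ complexReflections) :
    ∃ a ∈ realRoots, ∃ b ∈ realRoots, realify g = realReflection a * realReflection b := by
  obtain ⟨r, hr, lam, hlam, hgr⟩ := mem_complexReflections_iff.1 hg
  have hlam3 := pow_three_eq_one_of_mem_pair hlam
  have hrr := mirrorVectors_subset_realRoots hr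
  have hu : (lam ^ 2) ^ 3 = 1 := by rw [pow_right_comm, hlam3, one_pow]
  refine ⟨lam ^ 2 • r, smul_mem_realRoots (pow_six_eq_one_iff.2 (.inl hu)) hrr, r, hrr,
    DFunLike.coe_injective ?_⟩
  rw [hgr, realReflection_smul_mul hrr (star_mul_self_of_pow_eq_one hu), ← pow_mul,
    show lam ^ (2 * 2) = lam ^ 3 * lam by ring, hlam3, one_mul]

theorem map_realify_hessianGroup_le :
    hessianGroup.map realify ≤ rotationSubgroup realReflectionGroup := by
  rw [Subgroup.map_le_iff_le_comap]
  refine hessianGroup_le_closure_complexReflections.trans ((Subgroup.closure_le _).2 fun g hg => ?_)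
  obtain ⟨a, ha, b, hb, hgab⟩ := exists_realify_eq_mul_of_mem hg
  refine ⟨?_, ?_⟩
  · change realify g ∈ realReflectionGroup
    exact hgab ▸ mul_mem (realReflection_mem ha) (realReflection_mem hb)
  · change LinearEquiv.det (realify g) = 1
    rw [hgab, map_mul, det_realReflection ha, det_realReflection hb, neg_mul_neg, one_mul]

theorem realify_mem {g : GL (Fin 3) ℂ} (hg : g ∈ hessianGroup) :
    realify g ∈ realReflectionGroup :=
  (map_realify_hessianGroup_le (Subgroup.mem_map_of_mem realify hg)).1

theorem hdot_realify_realify {g : GL (Fin 3) ℂ} (hg : realify g ∈ realReflectionGroup) (x y : V) :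
    hdot (realify g x) (realify g y) = hdot x y := by
  have him : ∀ x y, (hdot x y).im = realForm x (Complex.I • y) := fun x y => by
    rw [realForm_apply, hdot_smul_right]
    simp
  refine Complex.ext (realForm_map_map hg x y) ?_
  rw [him, him, ← realify_smul, realForm_map_map hg]

theorem realify_unitaryReflection {g : GL (Fin 3) ℂ} (hg : realify g ∈ realReflectionGroup)
    (r : V) (lam : ℂ) (x : V) :
    realify g (unitaryReflection r lam x) =
      unitaryReflection (realify g r) lam (realify g x) := by
  rw [unitaryReflection, map_sub, realify_smul, unitaryReflection, hdot_realify_realify hg,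
    hdot_realify_realify hg]

/-! ### Transitivity and stabilizer -/

/-- The root `(√-3, 0, 0)`, the base point of the orbit computations. -/
def baseRoot : V := Pi.single 0 t

theorem baseRoot_mem : baseRoot ∈ realRoots := single_mem_realRoots 0

theorem realify_fourierGL_baseRoot : realify fourierGL baseRoot = 1 := by
  rw [realify_fourierGL]
  have h := t_mul_t
  ext i
  fin_cases i <;> simp [baseRoot] <;> linear_combination -h / 3

theorem realify_fourierGL_one : realify fourierGL 1 = -baseRoot := by
  rw [realify_fourierGL]
  have h := v_sq
  ext i
  fin_cases i <;> simp [baseRoot, w] <;> grind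

theorem exists_realify_baseRoot_eq_of_pow_three {c : V} (hc : c ^ 3 = 1) :
    ∃ g ∈ hessianGroup, realify g baseRoot = c :=
  ⟨_, mul_mem (diagGL_mem (cubeUnit_pow_three c hc)) fourierGL_mem, by
    rw [map_mul, LinearEquiv.mul_apply, realify_fourierGL_baseRoot, realify_diagGL, coe_cubeUnit,
      mul_one]⟩

theorem exists_realify_baseRoot_eq_neg {a : V}
    (ha : ∃ g ∈ hessianGroup, realify g baseRoot = -a) :
    ∃ g ∈ hessianGroup, realify g baseRoot = a := by
  obtain ⟨g, hg, hga⟩ := ha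
  refine ⟨_, mul_mem hg (mul_mem fourierGL_mem fourierGL_mem), ?_⟩
  rw [map_mul, map_mul, LinearEquiv.mul_apply, LinearEquiv.mul_apply, realify_fourierGL_baseRoot,
    realify_fourierGL_one, map_neg, hga, neg_neg]

theorem exists_realify_baseRoot_eq_single_and_fix_one (i : Fin 3) :
    ∃ g ∈ hessianGroup, realify g baseRoot = Pi.single i t ∧ realify g 1 = 1 := by
  have hstep : ∀ j : Fin 3, realify shiftGL (Pi.single (j + 1) t) = Pi.single j t := fun j => by
    rw [realify_shiftGL]
    ext k
    fin_cases j <;> fin_cases k <;> simp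
  have hone : realify shiftGL 1 = 1 := by
    rw [realify_shiftGL]
    ext k
    fin_cases k <;> rfl
  fin_cases i
  · exact ⟨1, one_mem _, by rw [map_one]; exact ⟨rfl, rfl⟩⟩
  · refine ⟨_, mul_mem shiftGL_mem shiftGL_mem, ?_⟩
    rw [map_mul, LinearEquiv.mul_apply, LinearEquiv.mul_apply, hone]
    exact ⟨(congrArg _ (hstep 2)).trans (hstep 1), hone⟩
  · exact ⟨_, shiftGL_mem, hstep 2, hone⟩

theorem exists_realify_baseRoot_eq_single (i : Fin 3) {u : ℂ} (hu : u ^ 3 = 1) :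
    ∃ g ∈ hessianGroup, realify g baseRoot = Pi.single i (u * t) := by
  obtain ⟨g, hg, hgi, -⟩ := exists_realify_baseRoot_eq_single_and_fix_one i
  refine ⟨_, mul_mem (diagGL_mem (cubeUnit_pow_three _ (mulSingle_pow_three i hu))) hg, ?_⟩
  rw [map_mul, LinearEquiv.mul_apply, hgi, realify_diagGL, coe_cubeUnit]
  ext k
  rcases eq_or_ne k i with rfl | hk <;> simp [*]

theorem exists_realify_baseRoot_eq {a : V} (ha : a ∈ realRoots) :
    ∃ g ∈ hessianGroup, realify g baseRoot = a := by
  rcases mem_realRoots_iff.1 ha with (h | h) | ⟨i, u, hu, rfl⟩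
  · exact exists_realify_baseRoot_eq_of_pow_three h
  · exact exists_realify_baseRoot_eq_neg (exists_realify_baseRoot_eq_of_pow_three h)
  · rcases pow_six_eq_one_iff.1 hu with h | h
    · exact exists_realify_baseRoot_eq_single i h
    · refine exists_realify_baseRoot_eq_neg ?_
      rw [← Pi.single_neg, ← neg_mul]
      exact exists_realify_baseRoot_eq_single i h

theorem exists_realify_eq_unitaryReflection {r : V} (hr : r ∈ realRoots) {lam : ℂ}
    (hlam : lam ^ 3 = 1) : ∃ g ∈ hessianGroup, ⇑(realify g) = unitaryReflection r lam := by
  obtain ⟨h, hh, rfl⟩ := exists_realify_baseRoot_eq hr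
  have hd := diagGL_mem (cubeUnit_pow_three _ (mulSingle_pow_three 0 hlam))
  refine ⟨_, mul_mem (mul_mem hh hd) (inv_mem hh), funext fun x => ?_⟩
  have hinv : realify h (realify h⁻¹ x) = x := by
    rw [map_inv]
    exact (realify h).apply_symm_apply x
  rw [map_mul, map_mul, LinearEquiv.mul_apply, LinearEquiv.mul_apply, realify_diagGL, coe_cubeUnit,
    ← unitaryReflection_single, realify_unitaryReflection (realify_mem hh), hinv, baseRoot]

theorem closure_complexReflections : Subgroup.closure complexReflections = hessianGroup := by
  refine le_antisymm ((Subgroup.closure_le _).2 fun g hg => ?_)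
    hessianGroup_le_closure_complexReflections
  obtain ⟨r, hr, lam, hlam, hgr⟩ := mem_complexReflections_iff.1 hg
  obtain ⟨h, hh, hhr⟩ :=
    exists_realify_eq_unitaryReflection (mirrorVectors_subset_realRoots hr)
      (pow_three_eq_one_of_mem_pair hlam)
  rwa [SetLike.mem_coe, realify_injective (DFunLike.coe_injective (hgr.trans hhr.symm))]

theorem eq_and_pow_three_of_sub_mem_rootLattice {i j k : Fin 3} (hi : i ≠ k) (hj : j ≠ k) {u : ℂ}
    (hu : u ^ 6 = 1) (h : Pi.single j 1 - Pi.single i u ∈ rootLattice) : i = j ∧ u ^ 3 = 1 := by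
  obtain ⟨p, hp, hpx⟩ := h
  have hk : p k = 0 := eis_injective (by simpa [hi.symm, hj.symm] using congrFun hpx k)
  have hres : ∀ l, residue (p l) = 0 := fun l => by rw [hp, ← hp k, hk, map_zero]
  obtain rfl : i = j := by
    by_contra hij
    have hpj : p j = 1 := eis_injective (by simpa [Ne.symm hij] using congrFun hpx j)
    simpa [hpj] using hres j
  refine ⟨rfl, ?_⟩
  have hpi : eis (1 - p i) = u := by
    rw [map_sub, map_one, show eis (p i) = 1 - u by simpa using congrFun hpx i, sub_sub_cancel]
  rw [← hpi, ← map_pow, pow_three_eq_one_of_residue_eq_one, map_one]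
  · exact eis_injective (by rw [map_pow, hpi, hu, map_one])
  · rw [map_sub, hres, map_one, sub_zero]

theorem realify_single_eq_iff {g : GL (Fin 3) ℂ} {i j : Fin 3} {u : ℂ} :
    realify g (Pi.single i t) = Pi.single j (u * t) ↔
      realify g (Pi.single i 1) = Pi.single j u := by
  have hsingle : ∀ (k : Fin 3) (z : ℂ), (Pi.single k (z * t) : V) = t • Pi.single k z :=
    fun k z => by rw [← Pi.single_smul, smul_eq_mul, mul_comm]
  rw [hsingle, ← one_mul t, hsingle, one_mul, realify_smul]
  exact smul_right_inj t_ne_zero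

theorem exists_realify_single_eq {g : GL (Fin 3) ℂ} (hg : realify g ∈ realReflectionGroup)
    (hgb : realify g (Pi.single 0 1) = Pi.single 0 1) {j : Fin 3} (hj : j ≠ 0) :
    ∃ u : ℂ, u ^ 3 = 1 ∧ realify g (Pi.single j 1) = Pi.single j u := by
  have hroot : realify g (Pi.single j t) ∈ realRoots :=
    apply_mem_realRoots hg (single_mem_realRoots j)
  have hzero : realify g (Pi.single j t) 0 = 0 := by
    have h := hdot_realify_realify hg (Pi.single j t) (Pi.single 0 1)
    rw [hgb, hdot_single_right, hdot_single_right, Pi.single_eq_of_ne hj.symm] at h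
    simpa using h
  rcases mem_realRoots_iff.1 hroot with (h | h) | ⟨i, u, hu, hgi⟩
  · simpa [hzero] using congrFun h 0
  · simpa [hzero] using congrFun h 0
  · have hi : i ≠ 0 := by
      rintro rfl
      have hu0 : u ≠ 0 := fun h => by simp [h] at hu
      rw [hgi, Pi.single_eq_same] at hzero
      exact mul_ne_zero hu0 t_ne_zero hzero
    have hgj := realify_single_eq_iff.1 hgi
    have hweight : Pi.single 0 1 - Pi.single j 1 ∈ weightLattice :=
      ⟨Pi.single 0 1 - Pi.single j 1, by simp, by ext k; simp [Pi.single_apply, apply_ite eis]⟩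
    have hsub := apply_sub_self_mem_rootLattice hg hweight
    rw [map_sub, hgb, hgj, sub_sub_sub_cancel_left] at hsub
    obtain ⟨rfl, hu3⟩ := eq_and_pow_three_of_sub_mem_rootLattice hi hj hu hsub
    exact ⟨u, hu3, hgj⟩

theorem exists_eq_diagGL {g : GL (Fin 3) ℂ} (hg : realify g ∈ realReflectionGroup)
    (hgb : realify g baseRoot = baseRoot) :
    ∃ (a b : ℂ) (ha : a ^ 3 = 1) (hb : b ^ 3 = 1),
      g = diagGL (cubeUnit ![1, a, b] (vec3_pow_three (one_pow 3) ha hb)) := by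
  have h0 : realify g (Pi.single 0 1) = Pi.single 0 1 :=
    realify_single_eq_iff.1 (by rwa [one_mul])
  obtain ⟨a, ha, hga⟩ := exists_realify_single_eq hg h0 (j := 1) (by decide)
  obtain ⟨b, hb, hgb⟩ := exists_realify_single_eq hg h0 (j := 2) (by decide)
  refine ⟨a, b, ha, hb, Units.ext (Matrix.ext_of_mulVec_single fun i => ?_)⟩
  rw [coe_diagGL, coe_cubeUnit, Matrix.diagonal_mulVec_single, mul_one]
  fin_cases i
  exacts [h0, hga, hgb]

theorem comap_realify_realReflectionGroup :
    realReflectionGroup.comap realify = hessianGroup := by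
  refine le_antisymm (fun g (hg : realify g ∈ realReflectionGroup) => ?_) fun g => realify_mem
  obtain ⟨h, hh, hhg⟩ := exists_realify_baseRoot_eq (apply_mem_realRoots hg baseRoot_mem)
  have hfix : realify (h⁻¹ * g) baseRoot = baseRoot := by
    rw [map_mul, LinearEquiv.mul_apply, ← hhg, map_inv]
    exact (realify h).symm_apply_apply _
  have hmem : realify (h⁻¹ * g) ∈ realReflectionGroup := by
    rw [map_mul]
    exact mul_mem (realify_mem (inv_mem hh)) hg
  obtain ⟨a, b, ha, hb, hab⟩ := exists_eq_diagGL hmem hfix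
  exact (mul_mem_cancel_left (inv_mem hh)).1 (hab ▸ diagGL_mem (cubeUnit_pow_three _ _))

theorem orbit_baseRoot :
    MulAction.orbit (hessianGroup.map realify) baseRoot = realRoots := by
  ext a
  constructor
  · rintro ⟨⟨_, g, hg, rfl⟩, rfl⟩
    exact apply_mem_realRoots (realify_mem hg) baseRoot_mem
  · intro ha
    obtain ⟨g, hg, rfl⟩ := exists_realify_baseRoot_eq ha
    exact ⟨⟨_, g, hg, rfl⟩, rfl⟩

theorem realify_diagGL_baseRoot {c : Vˣ} (hc : (c : V) 0 = 1) :
    realify (diagGL c) baseRoot = baseRoot := by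
  rw [realify_diagGL]
  ext i
  fin_cases i <;> simp [hc, baseRoot]

theorem card_stabilizer_baseRoot :
    Nat.card (MulAction.stabilizer (hessianGroup.map realify) baseRoot) = 9 := by
  let S := {u : ℂ | u ^ 3 = 1}
  let c : S × S → Vˣ := fun p =>
    cubeUnit ![1, p.1, p.2] (vec3_pow_three (one_pow 3) p.1.2 p.2.2)
  let f : S × S → MulAction.stabilizer (hessianGroup.map realify) baseRoot := fun p =>
    ⟨⟨realify (diagGL (c p)),
      Subgroup.mem_map_of_mem _ (diagGL_mem (cubeUnit_pow_three _ _))⟩, realify_diagGL_baseRoot rfl⟩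
  have hf : Function.Bijective f := by
    constructor
    · intro p q hpq
      have h : realify (diagGL (c p)) 1 = realify (diagGL (c q)) 1 :=
        congrArg (fun g => g.1.1 1) hpq
      rw [realify_diagGL, realify_diagGL, mul_one, mul_one] at h
      exact Prod.ext (Subtype.ext (congrFun h 1)) (Subtype.ext (congrFun h 2))
    · rintro ⟨⟨_, g, hg, rfl⟩, hgb⟩
      obtain ⟨a, b, ha, hb, rfl⟩ := exists_eq_diagGL (realify_mem hg) hgb
      exact ⟨(⟨a, ha⟩, ⟨b, hb⟩), rfl⟩
  rw [← Nat.card_eq_of_bijective f hf, Nat.card_prod, Nat.card_coe_set_eq, ncard_setOf_pow_eq_one]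

/-! ### Cardinalities -/

theorem mirrorCoords_mul_eq_imp_eq : ∀ m n : Fin 12,
    (∀ i j, mirrorCoords m i * mirrorCoords n j = mirrorCoords m j * mirrorCoords n i) →
      m = n := by
  decide +kernel

theorem eq_of_smul_comp_mirrorCoords_eq {m n : Fin 12} {a b : ℂ} (ha : a ≠ 0)
    (h : a • (eis ∘ mirrorCoords m) = b • (eis ∘ mirrorCoords n)) : m = n := by
  refine mirrorCoords_mul_eq_imp_eq m n fun i j => eis_injective (mul_left_cancel₀ ha ?_)
  have hi : a * eis (mirrorCoords m i) = b * eis (mirrorCoords n i) := congrFun h i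
  have hj : a * eis (mirrorCoords m j) = b * eis (mirrorCoords n j) := congrFun h j
  rw [map_mul, map_mul]
  linear_combination eis (mirrorCoords n j) * hi - eis (mirrorCoords n i) * hj

theorem eq_and_eq_of_smul_eq_smul {r r' : V} (hr : r ∈ mirrorVectors) (hr' : r' ∈ mirrorVectors)
    {a b : ℂ} (ha : a ≠ 0) (h : a • r = b • r') : r = r' ∧ a = b := by
  obtain ⟨m, rfl⟩ := mirrorVectors_eq_range ▸ hr
  obtain ⟨n, rfl⟩ := mirrorVectors_eq_range ▸ hr'
  obtain rfl := eq_of_smul_comp_mirrorCoords_eq ha h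
  exact ⟨rfl,
    smul_left_injective ℂ (ne_zero_of_mem_realRoots (mirrorVectors_subset_realRoots hr)) h⟩

theorem ncard_mirrorVectors : mirrorVectors.ncard = 12 := by
  have hinj : Function.Injective fun n => eis ∘ mirrorCoords n := fun m n h =>
    eq_of_smul_comp_mirrorCoords_eq one_ne_zero (congrArg ((1 : ℂ) • ·) h)
  rw [mirrorVectors_eq_range, ← Nat.card_coe_set_eq, Nat.card_range_of_injective hinj,
    Nat.card_fin]

theorem ncard_mirrors : mirrors.ncard = 12 := by
  rw [mirrors, Set.InjOn.ncard_image, ncard_mirrorVectors]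
  intro r hr r' hr' (h : Submodule.span ℂ {r} = Submodule.span ℂ {r'})
  obtain ⟨z, hz⟩ := Submodule.mem_span_singleton.1 (h ▸ Submodule.mem_span_singleton_self r)
  exact (eq_and_eq_of_smul_eq_smul hr hr' one_ne_zero (by rw [one_smul, hz])).1

theorem ncard_realRoots : realRoots.ncard = 72 := by
  have hroots : realRoots =
      (fun p : V × ℂ => p.2 • p.1) '' (mirrorVectors ×ˢ {u : ℂ | u ^ 6 = 1}) := by
    ext a
    simp [realRoots, and_assoc, eq_comm]
  rw [hroots, Set.InjOn.ncard_image, Set.ncard_prod, ncard_mirrorVectors, ncard_setOf_pow_eq_one]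
  rintro ⟨r, u⟩ ⟨hr, hu⟩ ⟨r', u'⟩ ⟨hr', -⟩ h
  have hu0 : u ≠ 0 := (Units.ofPowEqOne u 6 hu (by decide)).ne_zero
  exact Prod.ext_iff.2 (eq_and_eq_of_smul_eq_smul hr hr' hu0 h)

theorem card_hessianGroup : Nat.card hessianGroup = 648 := by
  rw [← Subgroup.card_map_of_injective realify_injective,
    ← (MulAction.stabilizer (hessianGroup.map realify) baseRoot).card_mul_index,
    MulAction.index_stabilizer, orbit_baseRoot, card_stabilizer_baseRoot, ncard_realRoots]

theorem sub_unitaryReflection_self {r : V} (hr : r ∈ realRoots) (lam : ℂ) :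
    r - unitaryReflection r lam r = (1 - lam) • r := by
  rw [unitaryReflection, hdot_self_of_mem hr, div_self three_ne_zero, one_mul, sub_sub_cancel]

theorem injOn_unitaryReflection :
    Set.InjOn (fun p : V × ℂ => unitaryReflection p.1 p.2) (mirrorVectors ×ˢ {v, w}) := by
  rintro ⟨r, lam⟩ ⟨hr : r ∈ mirrorVectors, hlam⟩ ⟨r', lam'⟩ ⟨hr', -⟩
    (h : unitaryReflection r lam = unitaryReflection r' lam')
  have hne : (1 : ℂ) - lam ≠ 0 := by
    rw [sub_ne_zero]
    rintro rfl
    rcases hlam with h1 | h1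
    exacts [isPrimitiveRoot_v.ne_one (by decide) h1.symm,
      isPrimitiveRoot_v.pow_ne_one_of_pos_of_lt two_ne_zero (by decide) h1.symm]
  have hsub : (1 - lam) • r = (hdot r r' / hdot r' r' * (1 - lam')) • r' := by
    rw [← sub_unitaryReflection_self (mirrorVectors_subset_realRoots hr), h,
      unitaryReflection, sub_sub_cancel]
  obtain ⟨rfl, hlam⟩ := eq_and_eq_of_smul_eq_smul hr hr' hne hsub
  rw [hdot_self_of_mem (mirrorVectors_subset_realRoots hr), div_self three_ne_zero, one_mul,
    sub_right_inj] at hlam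
  rw [hlam]

theorem ncard_complexReflections : complexReflections.ncard = 24 := by
  have himage : (fun g => ⇑(realify g)) '' complexReflections =
      (fun p : V × ℂ => unitaryReflection p.1 p.2) '' (mirrorVectors ×ˢ {v, w}) := by
    ext f
    constructor
    · rintro ⟨g, hg, rfl⟩
      obtain ⟨r, hr, lam, hlam, hgr⟩ := mem_complexReflections_iff.1 hg
      exact ⟨(r, lam), ⟨hr, hlam⟩, hgr.symm⟩
    · rintro ⟨⟨r, lam⟩, ⟨hr, hlam⟩, rfl⟩
      obtain ⟨g, -, hgr⟩ := exists_realify_eq_unitaryReflection (mirrorVectors_subset_realRoots hr)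
        (pow_three_eq_one_of_mem_pair hlam)
      exact ⟨g, mem_complexReflections_iff.2 ⟨r, hr, lam, hlam, hgr⟩, hgr⟩
  have hinj : Function.Injective fun g : GL (Fin 3) ℂ => ⇑(realify g) :=
    DFunLike.coe_injective.comp realify_injective
  rw [← Set.ncard_image_of_injective _ hinj, himage, injOn_unitaryReflection.ncard_image,
    Set.ncard_prod, ncard_mirrorVectors, Set.ncard_pair v_ne_w]

theorem injOn_realReflection_smul :
    Set.InjOn (fun p : V × ℂ => realReflection (p.2 • p.1))
      (mirrorVectors ×ˢ {u : ℂ | u ^ 3 = 1}) := by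
  rintro ⟨r, c⟩ ⟨hr, hc⟩ ⟨r', c'⟩ ⟨hr', hc'⟩ h
  have hmem : c' • r' ∈ realRoots := smul_mem_realRoots (pow_six_eq_one_iff.2 (.inl hc'))
    (mirrorVectors_subset_realRoots hr')
  obtain ⟨k, hk⟩ := exists_smul_eq_of_orthogonalReflection_eq (realForm_self_ne_zero_of_mem hmem) h
  rw [← Complex.coe_smul, smul_smul] at hk
  have hc0 : c' ≠ 0 := (Units.ofPowEqOne c' 3 hc' three_ne_zero).ne_zero
  obtain ⟨rfl, hck⟩ := eq_and_eq_of_smul_eq_smul hr' hr hc0 hk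
  have hk3 : (k : ℂ) ^ 3 = 1 := by
    have h3 : (k * c) ^ 3 = 1 := hck ▸ hc'
    rwa [mul_pow, show c ^ 3 = 1 from hc, mul_one] at h3
  have hk1 : k = 1 := (Odd.strictMono_pow (by decide : Odd 3)).injective
    ((mod_cast hk3 : k ^ 3 = 1).trans (one_pow 3).symm)
  rw [hck, hk1, Complex.ofReal_one, one_mul]

theorem ncard_realReflections : realReflections.ncard = 36 := by
  have himage : realReflections = (fun p : V × ℂ => realReflection (p.2 • p.1)) ''
      (mirrorVectors ×ˢ {u : ℂ | u ^ 3 = 1}) := by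
    rw [realReflections_eq_image]
    ext s
    constructor
    · rintro ⟨_, ⟨r, hr, u, hu, rfl⟩, rfl⟩
      rcases pow_six_eq_one_iff.1 hu with hu | hu
      · exact ⟨(r, u), ⟨hr, hu⟩, rfl⟩
      · exact ⟨(r, -u), ⟨hr, hu⟩, by
          simp only [neg_smul, realReflection, orthogonalReflection_neg]⟩
    · rintro ⟨⟨r, u⟩, ⟨hr, hu⟩, rfl⟩
      exact ⟨_, ⟨r, hr, u, pow_six_eq_one_iff.2 (.inl hu), rfl⟩, rfl⟩
  rw [himage, injOn_realReflection_smul.ncard_image, Set.ncard_prod, ncard_mirrorVectors,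
    ncard_setOf_pow_eq_one]

/-! ### The root system -/

theorem linearIndependent_of_det_ne_zero {R M ι : Type*} [CommRing R] [NoZeroDivisors R]
    [AddCommGroup M] [Module R M] [Fintype ι] [DecidableEq ι] {x : ι → M}
    (f : ι → Module.Dual R M) (h : (Matrix.of fun i j => f j (x i)).det ≠ 0) :
    LinearIndependent R x := by
  refine Fintype.linearIndependent_iff.2 fun c hc => congrFun ?_
  refine Matrix.eq_zero_of_vecMul_eq_zero h (funext fun j => ?_)
  simpa [Matrix.vecMul, dotProduct] using congrArg (f j) hc

/-- The map that sends each root `a` to its coroot `x ↦ 2 Re(x · a) / Re(a · a)`, using that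
`Re(a · a) = 3`. -/
def corootMap : V →ₗ[ℝ] Module.Dual ℝ V := (2 / 3 : ℝ) • realForm

theorem corootMap_apply (a x : V) : corootMap a x = 2 * realForm x a / 3 := by
  rw [realForm_isSymm.eq x a, mul_div_right_comm]
  rfl

theorem corootMap_injective : Function.Injective corootMap := by
  refine (injective_iff_map_eq_zero corootMap).2 fun a ha => funext fun i => ?_
  have h0 : ∑ i, ‖a i‖ ^ 2 = 0 := by
    rw [← realForm_self]
    simpa [corootMap_apply] using LinearMap.congr_fun ha a
  rw [Finset.sum_eq_zero_iff_of_nonneg fun i _ => by positivity] at h0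
  simpa using h0 i (Finset.mem_univ i)

theorem corootMap_self {a : V} (ha : a ∈ realRoots) : corootMap a a = 2 := by
  rw [corootMap_apply, realForm_self_of_mem ha, mul_div_cancel_right₀ _ three_ne_zero]

theorem exists_eq_corootMap {a b : V} (ha : a ∈ realRoots) (hb : b ∈ realRoots) :
    ∃ z : ℤ, (z : ℝ) = corootMap b a := by
  obtain ⟨n, hn⟩ := exists_two_mul_realForm_eq
    (rootLattice_le_weightLattice (mem_realRoots_iff_mem_rootLattice.1 ha).1)
    (mem_realRoots_iff_mem_rootLattice.1 hb).1
  exact ⟨n, by rw [corootMap_apply, hn, mul_div_cancel_left₀ _ three_ne_zero]⟩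

theorem realReflection_apply_of_mem {a : V} (ha : a ∈ realRoots) (x : V) :
    realReflection a x = x - corootMap a x • a := by
  rw [orthogonalReflection_apply, realForm_self_of_mem ha, corootMap_apply]

/-- Eisenstein coordinates of a system of simple roots, in the order of `CartanMatrix.E₆`. -/
def simpleCoords : Fin 6 → Fin 3 → Eisenstein :=
  ![![0, ⟨-1, 1⟩, 0], ![⟨1, -1⟩, 0, 0], ![0, ⟨2, 1⟩, 0], ![ω, ⟨-1, -1⟩, ⟨-1, -1⟩],
    ![0, 0, theta], ![0, 0, ⟨1, -1⟩]]

/-- The simple roots. -/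
def simpleRoot (j : Fin 6) : V := eis ∘ simpleCoords j

theorem residue_simpleCoords_and_sum_norm : ∀ j : Fin 6,
    (∀ i, residue (simpleCoords j i) = residue (simpleCoords j 0)) ∧
      ∑ i, (simpleCoords j i).norm = 3 := by
  decide +kernel

theorem simpleRoot_mem (j : Fin 6) : simpleRoot j ∈ realRoots := by
  obtain ⟨hres, hnorm⟩ := residue_simpleCoords_and_sum_norm j
  exact mem_realRoots_iff_mem_rootLattice.2
    ⟨⟨_, hres, rfl⟩, by rw [simpleRoot, realForm_eis_self, hnorm, Int.cast_ofNat]⟩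

theorem two_mul_re_sum_simpleCoords : ∀ i j : Fin 6,
    2 * (∑ k, simpleCoords i k * star (simpleCoords j k)).re -
      (∑ k, simpleCoords i k * star (simpleCoords j k)).im = 3 * CartanMatrix.E₆ i j := by
  decide +kernel

theorem corootMap_simpleRoot (i j : Fin 6) :
    corootMap (simpleRoot j) (simpleRoot i) = (CartanMatrix.E₆ i j : ℤ) := by
  have h := congrArg (Int.cast : ℤ → ℝ) (two_mul_re_sum_simpleCoords i j)
  push_cast at h
  rw [corootMap_apply, realForm_apply, simpleRoot, simpleRoot, hdot_eis, eis_re]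
  linear_combination h / 3

theorem linearIndependent_simpleRoot : LinearIndependent ℝ simpleRoot := by
  refine linearIndependent_of_det_ne_zero (corootMap ∘ simpleRoot) ?_
  have h : Matrix.of (fun i j => (corootMap ∘ simpleRoot) j (simpleRoot i)) =
      CartanMatrix.E₆.map (Int.castRingHom ℝ) :=
    Matrix.ext corootMap_simpleRoot
  rw [h, ← RingHom.mapMatrix_apply, ← RingHom.map_det, CartanMatrix.E₆_det]
  norm_num

theorem span_realRoots : Submodule.span ℝ realRoots = ⊤ := by
  have hcard : Fintype.card (Fin 6) = Module.finrank ℝ V := by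
    simp [Module.finrank_pi_fintype, Complex.finrank_real_complex]
  rw [eq_top_iff, ← linearIndependent_simpleRoot.span_eq_top_of_card_eq_finrank' hcard]
  exact Submodule.span_mono (Set.range_subset_iff.2 simpleRoot_mem)

/-- The coefficients of an element of the root lattice, given by its Eisenstein coordinates, with
respect to the simple roots. -/
def simpleCoeff (p : Fin 3 → Eisenstein) : Fin 6 → ℤ :=
  let n₄ := (p 0).re + (p 0).im
  let n₃ := ((p 1).re + (p 1).im + 2 * n₄) / 3
  let n₅ := ((p 2).re + (p 2).im + 2 * n₄) / 3
  ![(p 1).im + n₄ - n₃, (p 0).re, n₃, n₄, n₅, (p 2).re + n₄ - n₅]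

theorem simpleCoeff_smul_mirrorCoords : ∀ (n : Fin 12) (k : Fin 3),
    let p : Fin 3 → Eisenstein := (ω ^ (k : ℕ) : Eisenstein) • mirrorCoords n
    p = ∑ j, simpleCoeff p j • simpleCoords j ∧
      ((∀ j, 0 ≤ simpleCoeff p j) ∨ ∀ j, simpleCoeff p j ≤ 0) := by
  decide +kernel

theorem eis_comp_sum_zsmul (c : Fin 6 → ℤ) :
    eis ∘ (∑ j, c j • simpleCoords j) = ∑ j, c j • simpleRoot j := by
  ext i
  simp [simpleRoot]

theorem sum_smul_simpleRoot_mem_closure {c : Fin 6 → ℤ} (hc : ∀ j, 0 ≤ c j) :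
    ∑ j, c j • simpleRoot j ∈ AddSubmonoid.closure (Set.range simpleRoot) := by
  refine sum_mem fun j _ => ?_
  lift c to Fin 6 → ℕ using hc
  rw [natCast_zsmul]
  exact nsmul_mem (AddSubmonoid.subset_closure (Set.mem_range_self j)) _

theorem mem_or_neg_mem_closure_of_pow_three {r : V} (hr : r ∈ mirrorVectors) {u : ℂ}
    (hu : u ^ 3 = 1) : u • r ∈ AddSubmonoid.closure (Set.range simpleRoot) ∨
      -(u • r) ∈ AddSubmonoid.closure (Set.range simpleRoot) := by
  obtain ⟨n, rfl⟩ := mirrorVectors_eq_range ▸ hr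
  obtain ⟨k, rfl⟩ := exists_eis_pow_eq hu
  obtain ⟨hp, hsign⟩ := simpleCoeff_smul_mirrorCoords n k
  rw [eis_smul_comp, hp, eis_comp_sum_zsmul]
  refine hsign.imp sum_smul_simpleRoot_mem_closure fun h => ?_
  simp_rw [← Finset.sum_neg_distrib, ← neg_smul]
  exact sum_smul_simpleRoot_mem_closure fun j => neg_nonneg.2 (h j)

theorem mem_or_neg_mem_closure {a : V} (ha : a ∈ realRoots) :
    a ∈ AddSubmonoid.closure (Set.range simpleRoot) ∨
      -a ∈ AddSubmonoid.closure (Set.range simpleRoot) := by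
  obtain ⟨r, hr, u, hu, rfl⟩ := ha
  rcases pow_six_eq_one_iff.1 hu with h | h
  · exact mem_or_neg_mem_closure_of_pow_three hr h
  · simpa [or_comm] using mem_or_neg_mem_closure_of_pow_three hr h

instance finite_realRoots : Finite realRoots :=
  Set.finite_of_ncard_ne_zero (ncard_realRoots.trans_ne (by norm_num))

theorem exists_eq_rootPairing (a b : realRoots) :
    ∃ z : ℤ, (z : ℝ) = Module.Dual.eval ℝ V a (corootMap b) :=
  exists_eq_corootMap a.2 b.2

/-- The root system formed by `realRoots`. -/
def rootPairing : RootPairing realRoots ℝ V (Module.Dual ℝ V) :=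
  RootPairing.mk'' (Module.Dual.eval ℝ V) (Function.Embedding.subtype _)
    ((Function.Embedding.subtype _).trans ⟨corootMap, corootMap_injective⟩)
    (fun a => corootMap_self a.2)
    (by
      rintro a _ ⟨x, rfl⟩
      exact ⟨⟨_, apply_mem_realRoots (realReflection_mem a.2) x.2⟩,
        realReflection_apply_of_mem a.2 x⟩)
    ((congrArg (Submodule.span ℝ) Subtype.range_coe).trans span_realRoots)

instance isRootSystem_rootPairing : rootPairing.IsRootSystem :=
  RootPairing.isRootSystem_mk'' exists_eq_rootPairing

instance isCrystallographic_rootPairing : rootPairing.IsCrystallographic :=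
  ⟨exists_eq_rootPairing⟩

theorem rootPairing_root (a : realRoots) : rootPairing.root a = (a : V) := rfl

theorem rootPairing_reflection (a : realRoots) : rootPairing.reflection a = realReflection a :=
  LinearEquiv.ext fun x => (realReflection_apply_of_mem a.2 x).symm

theorem eq_one_or_eq_neg_one_of_smul_mem_realRoots {a : V} (ha : a ∈ realRoots) {k : ℝ}
    (hk : k • a ∈ realRoots) : k = 1 ∨ k = -1 := by
  have h := realForm_self_of_mem hk
  simp only [map_smul, LinearMap.smul_apply, smul_eq_mul, realForm_self_of_mem ha] at h
  rw [← sq_eq_one_iff]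
  linarith

instance isReduced_rootPairing : rootPairing.IsReduced := by
  refine ⟨fun a b h => ?_⟩
  simp only [rootPairing_root] at h ⊢
  rw [LinearIndependent.pair_iff' (ne_zero_of_mem_realRoots a.2)] at h
  push Not at h
  obtain ⟨k, hk⟩ := h
  rcases eq_one_or_eq_neg_one_of_smul_mem_realRoots a.2 (hk ▸ b.2) with rfl | rfl
  · exact .inl (by rw [← hk, one_smul])
  · exact .inr (by rw [← hk, neg_one_smul, neg_neg])

/-- The index of a simple root among all roots. -/
def simpleIndex : Fin 6 ↪ realRoots where
  toFun j := ⟨simpleRoot j, simpleRoot_mem j⟩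
  inj' _ _ h := linearIndependent_simpleRoot.injective (congrArg Subtype.val h)

theorem root_image_range_simpleIndex :
    rootPairing.root '' Set.range simpleIndex = Set.range simpleRoot :=
  (Set.range_comp _ _).symm

/-- The base of `rootPairing` formed by the simple roots. -/
def simpleBase : rootPairing.Base :=
  RootPairing.Base.mk' rootPairing (Set.range simpleIndex)
    ((linearIndepOn_range_iff simpleIndex.injective _).2 linearIndependent_simpleRoot)
    fun a => root_image_range_simpleIndex ▸ mem_or_neg_mem_closure a.2

/-- The numbering of the simple roots by the nodes of the Dynkin diagram. -/
def simpleBaseEquiv : Fin 6 ≃ simpleBase.support :=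
  (Equiv.ofInjective simpleIndex simpleIndex.injective).trans <|
    Equiv.setCongr (Set.toFinite (Set.range simpleIndex)).coe_toFinset.symm

theorem cartanMatrix_simpleBase :
    simpleBase.cartanMatrix.submatrix simpleBaseEquiv simpleBaseEquiv = CartanMatrix.E₆ := by
  ext i j
  have h := simpleBase.algebraMap_cartanMatrixIn_apply ℤ (simpleBaseEquiv i) (simpleBaseEquiv j)
  exact Int.cast_injective (h.trans (corootMap_simpleRoot i j))

theorem map_weightHom_weylGroup :
    rootPairing.weylGroup.map (RootPairing.Equiv.weightHom rootPairing) = realReflectionGroup := by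
  rw [← MonoidHom.domRestrict_range, RootPairing.range_weylGroup_weightHom, realReflectionGroup,
    realReflections_eq_image, Set.image_eq_range]
  simp_rw [← rootPairing_reflection]

theorem isE6WeylGroup : IsE6WeylGroup realRoots realReflectionGroup :=
  ⟨rootPairing, inferInstance, inferInstance, simpleBase, simpleBaseEquiv, rootPairing_root,
    cartanMatrix_simpleBase, map_weightHom_weylGroup⟩

/-! ### Linear and antilinear automorphisms -/

section Semilinear

variable {R S M N : Type*} [Semiring R] [Semiring S] [AddCommMonoid M] [Module R M]
  [AddCommMonoid N] [Module S N]

/-- The largest submodule on which the additive map `f` is semilinear with respect to `σ`. -/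
def semilinearLocus (f : M →+ N) (σ : R →+* S) : Submodule R M where
  carrier := {x | ∀ z : R, f (z • x) = σ z • f x}
  zero_mem' z := by simp
  add_mem' hx hy z := by rw [smul_add, map_add, hx, hy, map_add, smul_add]
  smul_mem' c x hx z := by rw [smul_smul, hx, hx, map_mul, mul_smul]

theorem mem_semilinearLocus {f : M →+ N} {σ : R →+* S} {x : M} :
    x ∈ semilinearLocus f σ ↔ ∀ z : R, f (z • x) = σ z • f x := Iff.rfl

end Semilinear

theorem mem_of_sub_mem_or_mem {R M : Type*} [Ring R] [AddCommGroup M] [Module R M]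
    {P Q : Submodule R M} (hPQ : Disjoint P Q) {x y : M} (hx : x ∈ P) (hx0 : x ≠ 0)
    (hy : y ∈ P ∨ y ∈ Q) (hxy : x - y ∈ P ∨ x - y ∈ Q) : y ∈ P := by
  rcases hy, hxy with ⟨hy | hy, hxy | hxy⟩
  · exact hy
  · exact hy
  · simpa using sub_mem hx hxy
  · refine absurd (Submodule.disjoint_def.1 hPQ x hx ?_) hx0
    simpa using add_mem hxy hy

theorem exists_eq_add_mul_v (z : ℂ) : ∃ α β : ℝ, z = α + β * v := by
  refine ⟨z.re - z.im / v.im * v.re, z.im / v.im, Complex.ext ?_ ?_⟩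
  · simp
  · simp [v_im_ne_zero]

theorem mem_semilinearLocus_of_apply_v_smul {g : V ≃ₗ[ℝ] V} {σ : ℂ →+* ℂ}
    (hσ : ∀ α : ℝ, σ α = α) {x : V} (hx : g (v • x) = σ v • g x) :
    x ∈ semilinearLocus (g : V →+ V) σ := by
  refine mem_semilinearLocus.2 fun z => ?_
  obtain ⟨α, β, rfl⟩ := exists_eq_add_mul_v z
  simp only [AddMonoidHom.coe_coe, map_add, map_mul, hσ, add_smul, mul_smul, Complex.coe_smul,
    map_smul, hx]

theorem disjoint_semilinearLocus {R S M N : Type*} [Semiring R] [Field S] [AddCommMonoid M]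
    [Module R M] [AddCommGroup N] [Module S N] {f : M →+ N} (hf : Function.Injective f)
    {σ τ : R →+* S} (hστ : σ ≠ τ) : Disjoint (semilinearLocus f σ) (semilinearLocus f τ) := by
  obtain ⟨z, hz⟩ := DFunLike.ne_iff.1 hστ
  refine Submodule.disjoint_def.2 fun x hx hx' => (map_eq_zero_iff f hf).1 ?_
  have h : (σ z - τ z) • f x = 0 := by rw [sub_smul, ← hx, ← hx', sub_self]
  exact (smul_eq_zero.1 h).resolve_left (sub_ne_zero.2 hz)

theorem eq_top_of_forall_single_mem {P : Submodule ℂ V} (h : ∀ i, Pi.single i t ∈ P) : P = ⊤ := by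
  refine eq_top_iff.2 fun x _ => ?_
  rw [← Finset.univ_sum_single x]
  refine sum_mem fun i _ => ?_
  have hi := P.smul_mem (x i / t) (h i)
  rwa [← Pi.single_smul, smul_eq_mul, div_mul_cancel₀ _ t_ne_zero] at hi

theorem v_smul_one_sub_single (i : Fin 3) :
    v • (1 : V) - Pi.single i t = v • Pi.mulSingle i v := by
  ext j
  rcases eq_or_ne j i with rfl | hj
  · simp [t, w, sq]
  · simp [hj]

theorem eq_top_or_eq_top_of_forall_realRoots_mem {P Q : Submodule ℂ V} (hPQ : Disjoint P Q)
    (h : ∀ a ∈ realRoots, a ∈ P ∨ a ∈ Q) : P = ⊤ ∨ Q = ⊤ := by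
  have hone : v • (1 : V) ∈ realRoots :=
    smul_mem_realRoots v_pow_six (mem_realRoots_of_pow_three (one_pow 3))
  wlog hP : v • (1 : V) ∈ P generalizing P Q
  · exact (this hPQ.symm (fun a ha => (h a ha).symm) ((h _ hone).resolve_left hP)).symm
  refine .inl (eq_top_of_forall_single_mem fun i => ?_)
  have hsub : v • (1 : V) - Pi.single i t ∈ realRoots :=
    v_smul_one_sub_single i ▸ smul_mem_realRoots v_pow_six
      (mem_realRoots_of_pow_three (mulSingle_pow_three i v_pow_three))
  exact mem_of_sub_mem_or_mem hPQ hP (ne_zero_of_mem_realRoots hone)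
    (h _ (single_mem_realRoots i)) (h _ hsub)

theorem mem_map_realify_of_semilinearLocus_eq_top {g : V ≃ₗ[ℝ] V} (hg : g ∈ realReflectionGroup)
    (h : semilinearLocus (g : V →+ V) (RingHom.id ℂ) = ⊤) : g ∈ hessianGroup.map realify := by
  let f : V ≃ₗ[ℂ] V := { g with
    map_smul' := fun z x => mem_semilinearLocus.1 (h ▸ Submodule.mem_top) z }
  let A : GL (Fin 3) ℂ := Matrix.GeneralLinearGroup.toLin.symm
    (LinearMap.GeneralLinearGroup.ofLinearEquiv f)
  have hA : realify A = g := by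
    ext1 x
    have h := Matrix.GeneralLinearGroup.toLin_apply A x
    rw [MulEquiv.apply_symm_apply] at h
    exact h.symm
  have hmem : A ∈ realReflectionGroup.comap realify := by rwa [Subgroup.mem_comap, hA]
  exact ⟨A, comap_realify_realReflectionGroup ▸ hmem, hA⟩

theorem exists_mem_realReflectionGroup_apply_eq_star :
    ∃ k ∈ realReflectionGroup, LinearEquiv.det k = -1 ∧ ∀ x, k x = star x := by
  have hmem : ∀ i, realReflection (Pi.single i t) ∈ realReflectionGroup := fun i =>
    realReflection_mem (single_mem_realRoots i)
  refine ⟨realReflection (Pi.single 0 t) * realReflection (Pi.single 1 t) *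
    realReflection (Pi.single 2 t), mul_mem (mul_mem (hmem 0) (hmem 1)) (hmem 2), ?_, fun x => ?_⟩
  · simp only [map_mul, det_realReflection (single_mem_realRoots _), mul_neg, mul_one, neg_neg]
  · simp only [LinearEquiv.mul_apply, realReflection_single]
    ext i
    fin_cases i <;> simp

theorem eq_v_or_eq_w {g : V ≃ₗ[ℝ] V} (hg : g ∈ realReflectionGroup) {a : V} (ha : a ∈ realRoots)
    {z : ℂ} (h : g (v • a) = z • g a) : z = v ∨ z = w := by
  have hga := hdot_self_of_mem (apply_mem_realRoots hg ha)
  have hre : z.re = v.re := by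
    have h1 := realForm_map_map hg (v • a) a
    rw [h, realForm_apply, realForm_apply, hdot_smul_left, hdot_smul_left, hga,
      hdot_self_of_mem ha] at h1
    simpa using h1
  have hroot : v • a ∈ realRoots :=
    smul_mem_realRoots (v_pow_six) ha
  have hnorm : z * star z = 1 := by
    have h2 := hdot_self_of_mem (apply_mem_realRoots hg hroot)
    rw [h, hdot_smul_left, hdot_smul_right, hga, ← mul_assoc] at h2
    exact mul_right_cancel₀ three_ne_zero (h2.trans (one_mul 3).symm)
  have hsum : z + star z = -1 := by
    rw [Complex.star_def, Complex.add_conj, hre, v_re]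
    norm_num
  have hvw : (z - v) * (z - w) = 0 := by
    rw [w]
    linear_combination z * hsum - hnorm + v_pow_three - z * v_sq
  exact (mul_eq_zero.1 hvw).imp sub_eq_zero.1 sub_eq_zero.1

theorem neg_one_ne_one_units : (-1 : ℝˣ) ≠ 1 := fun h =>
  absurd (congrArg Units.val h) (by norm_num)

theorem exists_mem_realRoots_forall_ne_smul {g : V ≃ₗ[ℝ] V}
    (hg : g ∈ rotationSubgroup realReflectionGroup) (hgH : g ∉ hessianGroup.map realify) :
    ∃ a ∈ realRoots, ∀ z : ℂ, g (v • a) ≠ z • g a := by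
  by_contra! hmul
  have hσ : RingHom.id ℂ ≠ starRingEnd ℂ := fun h => v_ne_w ((DFunLike.congr_fun h v).trans star_v)
  have hdich : ∀ a ∈ realRoots, a ∈ semilinearLocus (g : V →+ V) (RingHom.id ℂ) ∨
      a ∈ semilinearLocus (g : V →+ V) (starRingEnd ℂ) := fun a ha => by
    obtain ⟨z, hz⟩ := hmul a ha
    obtain rfl | rfl := eq_v_or_eq_w hg.1 ha hz
    · exact .inl (mem_semilinearLocus_of_apply_v_smul (fun _ => rfl) hz)
    · refine .inr (mem_semilinearLocus_of_apply_v_smul Complex.conj_ofReal ?_)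
      rw [hz, ← star_v, Complex.star_def]
  rcases eq_top_or_eq_top_of_forall_realRoots_mem (disjoint_semilinearLocus g.injective hσ) hdich
    with hlin | hanti
  · exact hgH (mem_map_realify_of_semilinearLocus_eq_top hg.1 hlin)
  obtain ⟨k, hk, hkdet, hkx⟩ := exists_mem_realReflectionGroup_apply_eq_star
  have hkg : k * g ∈ hessianGroup.map realify := by
    refine mem_map_realify_of_semilinearLocus_eq_top (mul_mem hk hg.1) ?_
    refine eq_top_iff.2 fun x _ z => ?_
    have hx : g (z • x) = star z • g x := mem_semilinearLocus.1 (hanti ▸ Submodule.mem_top) z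
    change k (g (z • x)) = z • k (g x)
    rw [hx, hkx, hkx, star_smul, star_star]
  have hdet : LinearEquiv.det (k * g) = 1 := (map_realify_hessianGroup_le hkg).2
  rw [map_mul, hkdet, show LinearEquiv.det g = 1 from hg.2, mul_one] at hdet
  exact neg_one_ne_one_units hdet

/-! ### Maximality -/

section Coset

variable {L : Subgroup (V ≃ₗ[ℝ] V)}

/-- The left coset of a subgroup `L` containing the reflection in the root `a`. Two roots have the
same coset if and only if the product of their reflections belongs to `L`. -/
def reflectionCoset (L : Subgroup (V ≃ₗ[ℝ] V)) (a : V) : (V ≃ₗ[ℝ] V) ⧸ L :=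
  (realReflection a : V ≃ₗ[ℝ] V)

theorem reflectionCoset_eq_iff {a b : V} :
    reflectionCoset L a = reflectionCoset L b ↔ realReflection a * realReflection b ∈ L := by
  rw [reflectionCoset, reflectionCoset, QuotientGroup.eq, orthogonalReflection_inv]

theorem reflectionCoset_neg (a : V) : reflectionCoset L (-a) = reflectionCoset L a := by
  rw [reflectionCoset, reflectionCoset, realReflection, orthogonalReflection_neg]

theorem reflectionCoset_apply {g : V ≃ₗ[ℝ] V} (hg : g ∈ realReflectionGroup) (hgL : g ∈ L)
    (a : V) : reflectionCoset L (g a) = g • reflectionCoset L a := by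
  rw [reflectionCoset, reflectionCoset, MulAction.Quotient.smul_coe, smul_eq_mul, realReflection,
    ← orthogonalReflection_conj (realForm_map_map hg)]
  exact QuotientGroup.mk_mul_of_mem _ (inv_mem hgL)

theorem reflectionCoset_realify (hL : hessianGroup.map realify ≤ L) {g : GL (Fin 3) ℂ}
    (hg : g ∈ hessianGroup) (a : V) :
    reflectionCoset L (realify g a) = realify g • reflectionCoset L a :=
  reflectionCoset_apply (realify_mem hg) (hL (Subgroup.mem_map_of_mem realify hg)) a

theorem reflectionCoset_smul (hL : hessianGroup.map realify ≤ L) {a : V} (ha : a ∈ realRoots)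
    {u : ℂ} (hu : u ^ 6 = 1) :
    reflectionCoset L (u • a) = reflectionCoset L a := by
  obtain ⟨g, hg, hgx⟩ := exists_realify_eq_unitaryReflection ha (lam := u ^ 2)
    (by rw [← pow_mul, hu])
  rw [reflectionCoset_eq_iff]
  have hgu : realify g = realReflection (u • a) * realReflection a := DFunLike.coe_injective <|
    hgx.trans (realReflection_smul_mul ha (star_mul_self_of_pow_eq_one hu)).symm
  exact hL (hgu ▸ Subgroup.mem_map_of_mem realify hg)

theorem reflectionCoset_eq_baseRoot_of_pow_three (hL : hessianGroup.map realify ≤ L) {c : V}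
    (hc : c ^ 3 = 1)
    (h : reflectionCoset L c = reflectionCoset L baseRoot) {e : V} (he : e ^ 3 = 1) :
    reflectionCoset L e = reflectionCoset L baseRoot := by
  have hc0 : c 0 ^ 3 = 1 := congrFun hc 0
  have he0 : e 0 ^ 3 = 1 := congrFun he 0
  let u := c 0 * e 0 ^ 2
  have hu : u ^ 3 = 1 := by rw [mul_pow, hc0, pow_right_comm, he0, one_pow, mul_one]
  let d := u • e * c ^ 2
  have hd : d ^ 3 = 1 := by
    rw [mul_pow, smul_pow, hu, he, pow_right_comm, hc, one_pow, one_smul, mul_one]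
  have hd0 : d 0 = 1 := by
    change c 0 * e 0 ^ 2 * e 0 * c 0 ^ 2 = 1
    linear_combination e 0 ^ 3 * hc0 + he0
  have hdc : realify (diagGL (cubeUnit d hd)) c = u • e := by
    rw [realify_diagGL, coe_cubeUnit, mul_assoc, ← pow_succ, hc, mul_one]
  have hdiag := diagGL_mem (cubeUnit_pow_three d hd)
  calc reflectionCoset L e = reflectionCoset L (u • e) :=
        (reflectionCoset_smul hL (mem_realRoots_of_pow_three he)
          (pow_six_eq_one_iff.2 (.inl hu))).symm
    _ = realify (diagGL (cubeUnit d hd)) • reflectionCoset L baseRoot := by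
        rw [← hdc, reflectionCoset_realify hL hdiag, h]
    _ = reflectionCoset L baseRoot := by
        rw [← reflectionCoset_realify hL hdiag, realify_diagGL_baseRoot hd0]

theorem reflectionCoset_eq_baseRoot (hL : hessianGroup.map realify ≤ L) {c : V} (hc : c ^ 3 = 1)
    (h : reflectionCoset L c = reflectionCoset L baseRoot) {a : V} (ha : a ∈ realRoots) :
    reflectionCoset L a = reflectionCoset L baseRoot := by
  rcases mem_realRoots_iff.1 ha with (ha | ha) | ⟨i, u, hu, rfl⟩
  · exact reflectionCoset_eq_baseRoot_of_pow_three hL hc h ha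
  · rw [← reflectionCoset_neg]
    exact reflectionCoset_eq_baseRoot_of_pow_three hL hc h ha
  have hone := reflectionCoset_eq_baseRoot_of_pow_three hL hc h (one_pow 3)
  obtain ⟨g, hg, hgi, hg1⟩ := exists_realify_baseRoot_eq_single_and_fix_one i
  calc reflectionCoset L (Pi.single i (u * t)) = reflectionCoset L (realify g baseRoot) := by
        rw [single_mul_t, reflectionCoset_smul hL (single_mem_realRoots i) hu, hgi]
    _ = reflectionCoset L (realify g 1) := by
        rw [reflectionCoset_realify hL hg, ← hone, ← reflectionCoset_realify hL hg]
    _ = reflectionCoset L baseRoot := by rw [hg1, hone]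

end Coset

theorem rotationSubgroup_le_of_reflectionCoset_eq {L : Subgroup (V ≃ₗ[ℝ] V)} {b : V}
    (h : ∀ a ∈ realRoots, reflectionCoset L a = reflectionCoset L b) :
    rotationSubgroup realReflectionGroup ≤ L := by
  refine closure_inf_ker_le_of_forall_mul_mem neg_one_ne_one_units ?_ ?_ ?_ <;>
    rw [realReflections_eq_image]
  · exact Set.forall_mem_image.2 fun a ha => det_realReflection ha
  · exact Set.forall_mem_image.2 fun a _ => orthogonalReflection_mul_self a
  · exact Set.forall_mem_image.2 fun a ha => Set.forall_mem_image.2 fun a' ha' =>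
      reflectionCoset_eq_iff.1 ((h a ha).trans (h a' ha').symm)

theorem pow_three_or_neg_pow_three_of_realForm_baseRoot_ne_zero {c : V} (hc : c ∈ realRoots)
    (hcb : realForm c baseRoot ≠ 0) (hmul : ∀ z : ℂ, c ≠ z • baseRoot) :
    c ^ 3 = 1 ∨ (-c) ^ 3 = 1 := by
  refine (mem_realRoots_iff.1 hc).resolve_right ?_
  rintro ⟨i, u, -, rfl⟩
  rcases eq_or_ne i 0 with rfl | hi
  · exact hmul u (single_mul_t 0 u)
  · exact hcb (by rw [realForm_apply, baseRoot, hdot_single_right, Pi.single_eq_of_ne' hi,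
      zero_mul, Complex.zero_re])

theorem exists_pow_three_reflectionCoset_eq {L : Subgroup (V ≃ₗ[ℝ] V)}
    (hL : hessianGroup.map realify < L) (hLW : L ≤ rotationSubgroup realReflectionGroup) :
    ∃ c : V, c ^ 3 = 1 ∧ reflectionCoset L c = reflectionCoset L baseRoot := by
  obtain ⟨g, hgL, hgH⟩ := SetLike.exists_of_lt hL
  have hgW := (hLW hgL).1
  obtain ⟨a, ha, hmul⟩ := exists_mem_realRoots_forall_ne_smul (hLW hgL) hgH
  obtain ⟨h, hh, hb⟩ := exists_realify_baseRoot_eq (apply_mem_realRoots hgW ha)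
  let k := (realify h)⁻¹ * g
  have hkL : k ∈ L := mul_mem (inv_mem (hL.le (Subgroup.mem_map_of_mem realify hh))) hgL
  have hkW : k ∈ realReflectionGroup := (hLW hkL).1
  have hk : ∀ x, realify h (k x) = g x := fun x => (realify h).apply_symm_apply (g x)
  have hka : k a = baseRoot := (realify h).injective ((hk a).trans hb.symm)
  have hcoset : reflectionCoset L (k (v • a)) = reflectionCoset L baseRoot := by
    rw [reflectionCoset_apply hkW hkL, reflectionCoset_smul hL.le ha v_pow_six,
      ← reflectionCoset_apply hkW hkL, hka]
  have hne : realForm (k (v • a)) baseRoot ≠ 0 := by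
    rw [← hka, realForm_map_map hkW, realForm_apply, hdot_smul_left, hdot_self_of_mem ha]
    norm_num [v_re]
  have hc := pow_three_or_neg_pow_three_of_realForm_baseRoot_ne_zero
    (apply_mem_realRoots hkW (smul_mem_realRoots v_pow_six ha)) hne fun z hz =>
      hmul z (by rw [← hk, hz, realify_smul, hb])
  rcases hc with hc | hc
  · exact ⟨_, hc, hcoset⟩
  · exact ⟨_, hc, (reflectionCoset_neg _).trans hcoset⟩

theorem map_realify_hessianGroup_ne :
    hessianGroup.map realify ≠ rotationSubgroup realReflectionGroup := by
  intro h
  let s := realReflection (Pi.single 0 t) * realReflection (Pi.single 1 t)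
  have hs : ∀ x : V, s x = ![star (x 0), star (x 1), x 2] := fun x => by
    simp only [s, LinearEquiv.mul_apply, realReflection_single]
    ext i
    fin_cases i <;> simp
  have hrot : s ∈ rotationSubgroup realReflectionGroup := by
    refine ⟨mul_mem (realReflection_mem (single_mem_realRoots 0))
      (realReflection_mem (single_mem_realRoots 1)), ?_⟩
    change LinearEquiv.det s = 1
    rw [map_mul, det_realReflection (single_mem_realRoots 0),
      det_realReflection (single_mem_realRoots 1), neg_mul_neg, one_mul]
  obtain ⟨g, -, hg⟩ := h ▸ hrot
  have hlin := realify_smul g v 1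
  rw [hg, hs, hs] at hlin
  have h0 : star v = v := by simpa using congrFun hlin 0
  exact v_ne_w (h0.symm.trans star_v)

theorem isMaximalSubgroupOf_rotationSubgroup :
    IsMaximalSubgroupOf (hessianGroup.map realify) (rotationSubgroup realReflectionGroup) := by
  refine ⟨lt_of_le_of_ne map_realify_hessianGroup_le map_realify_hessianGroup_ne,
    fun L hL hLW => hLW.antisymm ?_⟩
  obtain ⟨c, hc, hcb⟩ := exists_pow_three_reflectionCoset_eq hL hLW
  exact rotationSubgroup_le_of_reflectionCoset_eq fun a ha =>
    reflectionCoset_eq_baseRoot hL.le hc hcb ha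

end HessianE6

end

theorem mainTheorem5 :
    -- the group of order 648, its twelve mirrors and its generation by reflections
    (Nat.card HessianE6.hessianGroup = 648 ∧
      HessianE6.mirrors.ncard = 12 ∧
      HessianE6.complexReflections.ncard = 24 ∧
      Subgroup.closure HessianE6.complexReflections = HessianE6.hessianGroup) ∧
    -- the real reflections, and the group that they generate
    (HessianE6.realRoots.ncard = 72 ∧
      HessianE6.realReflections.ncard = 36 ∧
      HessianE6.IsE6WeylGroup HessianE6.realRoots HessianE6.realReflectionGroup) ∧
    -- the group of order 648 is maximal in the rotation subgroup
    (Function.Injective HessianE6.realify ∧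
      HessianE6.IsMaximalSubgroupOf (HessianE6.hessianGroup.map HessianE6.realify)
        (HessianE6.rotationSubgroup HessianE6.realReflectionGroup)) := by
  exact ⟨⟨HessianE6.card_hessianGroup, HessianE6.ncard_mirrors,
      HessianE6.ncard_complexReflections, HessianE6.closure_complexReflections⟩,
    ⟨HessianE6.ncard_realRoots, HessianE6.ncard_realReflections, HessianE6.isE6WeylGroup⟩,
    HessianE6.realify_injective, HessianE6.isMaximalSubgroupOf_rotationSubgroup⟩
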